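/- Let $k, r \ge 1$ be integers and put $\delta_0 = (2r)^{-2^{k+1}}$ and $\alpha = 2^5 r k (2r)^{2^{k+1}}$. Let $H$ be a complete $k$-uniform hypergraph $K_n^{(k)}$ whose edges are coloured with $r$ colours, and let $X, Z$ be disjoint subsets of $V(H)$ such that $|X| \ge \alpha |Z|$. Then there exists a set $\mathcal{C}$ of vertex-disjoint monochromatic $k$-uniform tight cycles in $H$ such that every vertex of $Z$ lies in a cycle of $\mathcal{C}$, $|\mathcal{C}| \le 2^{18}\, r\, \delta_0^{-5}$, and $|V(\mathcal{C}) \cap X| = (k-1)|Z|$, where $V(\mathcal{C})$ is the set of vertices of the cycles in $\mathcal{C}$. Here a $k$-uniform tight cycle is a $k$-uniform hypergraph on $m > k$ vertices that can be cyclically ordered so that the edges are exactly the sets of $k$ consecutive vertices; moreover, any non-empty set of at most $k$ vertices (carrying a single edge if it has exactly $k$ vertices, and no edge otherwise) counts as a degenerate tight cycle. A cycle is monochromatic if all its edges have the same colour. -/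

import Mathlib

/-- An edge-colouring of the complete `k`-graph on the vertex set `V` with `r` colours:
every `k`-element subset of `V` receives a colour in `Fin r`. -/
abbrev CompleteColouring (V : Type*) (k r : ℕ) : Type _ :=
  Set.powersetCard V k → Fin r

/-- `C` is a genuine `k`-uniform tight cycle: its vertices can be cyclically ordered as
`c 0, …, c (m - 1)` (pairwise distinct, `m > k`), and its edges are exactly the `m` sets of `k`
cyclically consecutive vertices. -/
def IsProperTightCycle {V : Type*} (k : ℕ) (C : Hypergraph V) : Prop :=
  ∃ (m : ℕ) (c : ℕ → V), k < m ∧ Set.InjOn c (Set.Iio m) ∧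
    C.vertexSet = c '' Set.Iio m ∧
    C.edgeSet = {e | ∃ i < m, e = (fun j => c ((i + j) % m)) '' Set.Iio k}

/-- `C` is a degenerate `k`-uniform cycle: a non-empty set of at most `k` vertices, whose edges are
all its `k`-subsets (so a single edge if it has `k` vertices, and no edge otherwise). -/
def IsDegenerateCycle {V : Type*} (k : ℕ) (C : Hypergraph V) : Prop :=
  C.vertexSet.Nonempty ∧ C.vertexSet.encard ≤ k ∧
    C.edgeSet = {e | e ⊆ C.vertexSet ∧ e.encard = k}

/-- A `k`-uniform tight cycle, degenerate cycles included. -/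
def IsTightCycle {V : Type*} (k : ℕ) (C : Hypergraph V) : Prop :=
  IsProperTightCycle k C ∨ IsDegenerateCycle k C

/-- All edges of the `k`-graph `C` have the same colour. -/
def IsMonochromatic {V : Type*} {k r : ℕ} (φ : CompleteColouring V k r) (C : Hypergraph V) : Prop :=
  ∃ j : Fin r, ∀ e : Set.powersetCard V k, ((e : Finset V) : Set V) ∈ C.edgeSet → φ e = j

/-- The constant `δ₀ = (2r)^{-2^{k+1}}`. -/
noncomputable def deltaZero (k r : ℕ) : ℝ :=
  ((2 * (r : ℝ)) ^ (2 ^ (k + 1)))⁻¹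

/-! Put n = k - 1. A tight cycle can be built from blocks, each a vertex of Z followed by an n-tuple
in X: every window of k consecutive vertices consists of one z and a mixture of the tuples on its
two sides. So z should sit between two tuples all of whose 2^n mixtures lie in its link in one fixed
colour: a `Cube`.

Each z outside X has a colour in which its link has density at least 1/(2r), once |X| ≥ 2n², so Z
splits into r classes. Few sets of density δ can have pairwise intersections below δ²/2
(`card_mul_lt_two_of_inter_lt`), hence in a class all but fewer than 4r vertices can be matched into
pairs whose common link has density at least d = 1/(8r²). Repeated Cauchy–Schwarz makes a proportion
p = d^(2^n) of all pairs of tuples cubes in this common link (`card_cube_ge`). Dependent random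
choice then yields a hub of density p/2 in which almost any two tuples are joined by many paths of
two cubes (`exists_hub`). Such a path uses up two vertices of Z, which is why they come in pairs.

Join two pairs when their hubs meet in density at least p²/8. The same bound on families, applied to
hubs, shows that independent sets of this graph have size below 4/p, so Pósa's argument splits it
into at most that many cycles, edges and single vertices. Around a cycle, tuples are chosen in
consecutive intersections and then joined inside each hub (`exists_cyclic_tuples`), which gives one
tight cycle through all the pairs on it.

These choices need room in X. Covers are therefore required to avoid any small forbidden set, and a
large Z is cut into boundedly many parts that are covered one after another from what is left of X;
a small Z is covered by degenerate cycles. -/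

/-! ### Density: almost disjoint families, cubes, dependent random choice -/

open Finset in
/-- A family of sets, each of density at least `δ`, with pairwise intersections of density less
than `δ ^ 2 / 2`, has fewer than `2 / δ` members. -/
theorem card_mul_lt_two_of_inter_lt {ι Ω : Type*} [Fintype Ω] [DecidableEq Ω] (I : Finset ι)
    (S : ι → Finset Ω) {δ : ℝ} (hδ : 0 < δ) (hΩ : 0 < Fintype.card Ω)
    (hS : ∀ i ∈ I, δ * Fintype.card Ω ≤ #(S i))
    (hI : ∀ i ∈ I, ∀ j ∈ I, i ≠ j → (#(S i ∩ S j) : ℝ) < δ ^ 2 / 2 * Fintype.card Ω) :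
    #I * δ < 2 := by
  classical
  by_contra! h
  set N : ℝ := (Fintype.card Ω : ℝ) with hN
  have hN0 : 0 < N := by rw [hN]; exact_mod_cast hΩ
  set T : ℝ := ∑ i ∈ I, (#(S i) : ℝ) with hT
  have hdeg : ∑ x : Ω, ∑ i ∈ I, (if x ∈ S i then (1 : ℝ) else 0) = T := by
    rw [sum_comm, hT]
    refine sum_congr rfl fun i _ => ?_
    simp
  have hsq : ∑ x : Ω, (∑ i ∈ I, (if x ∈ S i then (1 : ℝ) else 0)) ^ 2
      = ∑ i ∈ I, ∑ j ∈ I, (#(S i ∩ S j) : ℝ) := by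
    simp_rw [sq, sum_mul_sum]
    rw [sum_comm]
    refine sum_congr rfl fun i _ => ?_
    rw [sum_comm]
    refine sum_congr rfl fun j _ => ?_
    simp [← ite_and, ← mem_inter, inter_comm]
  -- Cauchy–Schwarz gives T² ≤ N ∑ |S i ∩ S j| < N T + (|I| δ N)² / 2, and T ≥ |I| δ N ≥ 2N bounds
  -- each summand on the right by T² / 2.
  have hcs := sq_sum_le_card_mul_sum_sq (s := (univ : Finset Ω))
    (f := fun x => ∑ i ∈ I, (if x ∈ S i then (1 : ℝ) else 0))
  rw [hdeg, hsq, card_univ, ← hN] at hcs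
  have hTge : #I * (δ * N) ≤ T := by
    rw [hT, ← nsmul_eq_mul]
    exact card_nsmul_le_sum _ _ _ hS
  have hIpos : (0 : ℝ) < #I := by
    by_contra! h0
    nlinarith
  have hne : I.Nonempty := by
    rw [← card_pos]; exact_mod_cast hIpos
  have hle : ∑ i ∈ I, ∑ j ∈ I, (#(S i ∩ S j) : ℝ)
      < ∑ i ∈ I, (#(S i) + #I * (δ ^ 2 / 2 * N)) := by
    refine sum_lt_sum_of_nonempty hne fun i hi => ?_
    rw [← add_sum_erase I _ hi, inter_self]
    have h1 : ∑ j ∈ I.erase i, (#(S i ∩ S j) : ℝ) ≤ #(I.erase i) • (δ ^ 2 / 2 * N) :=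
      sum_le_card_nsmul _ _ _ fun j hj =>
        (hI i hi j (mem_of_mem_erase hj) (ne_of_mem_erase hj).symm).le
    have h2 : (#(I.erase i) : ℝ) < #I := by
      exact_mod_cast card_erase_lt_of_mem hi
    have h3 : 0 < δ ^ 2 / 2 * N := by positivity
    rw [nsmul_eq_mul] at h1
    nlinarith
  rw [sum_add_distrib, ← hT, sum_const, nsmul_eq_mul] at hle
  have h2 : 2 * N ≤ T := by nlinarith
  have h3 : T ^ 2 < N * T + (#I * (δ * N)) ^ 2 / 2 := by
    have : N * (T + #I * (#I * (δ ^ 2 / 2 * N))) = N * T + (#I * (δ * N)) ^ 2 / 2 := by ring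
    rw [← this]
    exact hcs.trans_lt (mul_lt_mul_of_pos_left hle hN0)
  have h4 : (#I * (δ * N)) ^ 2 ≤ T ^ 2 := pow_le_pow_left₀ (by positivity) hTge 2
  nlinarith

/-- All the tuples that mix the coordinates of `x` and `y` belong to `M`. -/
def Cube {n : ℕ} {A : Type*} (M : Set (Fin n → A)) (x y : Fin n → A) : Prop :=
  ∀ s : Fin n → Bool, (fun i => if s i then x i else y i) ∈ M

theorem Cube.symm {n : ℕ} {A : Type*} {M : Set (Fin n → A)} {x y : Fin n → A} (h : Cube M x y) :
    Cube M y x := by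
  intro s
  convert h (fun i => !s i) using 2 with i
  cases s i <;> simp

theorem Cube.left_mem {n : ℕ} {A : Type*} {M : Set (Fin n → A)} {x y : Fin n → A}
    (h : Cube M x y) : x ∈ M := by simpa using h fun _ => true

/-- The first coordinate of a mixture is chosen independently of the rest, so each mixed tail must
be admissible after both `a` and `b`. This drives the induction on the dimension in `card_cube_ge`.
-/
theorem cube_cons {n : ℕ} {A : Type*} (M : Set (Fin (n + 1) → A)) (a b : A) (x y : Fin n → A) :
    Cube M (Fin.cons a x) (Fin.cons b y) ↔
      Cube {w | (Fin.cons a w : Fin (n + 1) → A) ∈ M ∧ (Fin.cons b w : Fin (n + 1) → A) ∈ M}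
        x y := by
  have key : ∀ (t : Bool) (s : Fin n → Bool),
      (fun i => if (Fin.cons t s : Fin (n + 1) → Bool) i then (Fin.cons a x : Fin (n + 1) → A) i
        else (Fin.cons b y : Fin (n + 1) → A) i)
      = Fin.cons (if t then a else b) (fun i => if s i then x i else y i) := by
    intro t s
    funext i
    refine Fin.cases ?_ (fun i => ?_) i <;> simp
  constructor
  · intro h s
    constructor
    · have := h (Fin.cons true s)
      rwa [key] at this
    · have := h (Fin.cons false s)
      rwa [key] at this
  · intro h s
    rw [← Fin.cons_self_tail s, key]
    have := h (Fin.tail s)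
    cases s 0
    · exact this.2
    · exact this.1

open Classical Finset in
/-- A set of `n`-tuples of density `d` contains at least `d ^ 2 ^ n` of all the cubes. -/
theorem card_cube_ge {A : Type*} [Fintype A] [Nonempty A] : ∀ (n : ℕ) (M : Set (Fin n → A)),
    ((#{x | x ∈ M} : ℝ) / Fintype.card (Fin n → A)) ^ 2 ^ n * (Fintype.card (Fin n → A) : ℝ) ^ 2
      ≤ #{q : (Fin n → A) × (Fin n → A) | Cube M q.1 q.2} := by
  intro n
  induction n with
  | zero =>
    intro M
    have hc : Fintype.card (Fin 0 → A) = 1 := by simp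
    rw [hc]
    by_cases h : (default : Fin 0 → A) ∈ M
    · have h1 : ∀ q : (Fin 0 → A) × (Fin 0 → A), Cube M q.1 q.2 := by
        intro q s
        rwa [Subsingleton.elim (fun i => if s i then q.1 i else q.2 i) default]
      have h2 : ∀ x : Fin 0 → A, x ∈ M := fun x => by rwa [Subsingleton.elim x default]
      simp [h1, h2]
    · have h2 : ∀ x : Fin 0 → A, x ∉ M := fun x => by rwa [Subsingleton.elim x default]
      simp [h2]
  | succ n ih =>
    intro M
    set K : ℝ := (Fintype.card A : ℝ) with hK
    have hK0 : 0 < K := by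
      have : 0 < Fintype.card A := Fintype.card_pos
      rw [hK]; exact_mod_cast this
    set N : ℝ := (Fintype.card (Fin n → A) : ℝ) with hN
    have hN0 : 0 < N := by
      have : 0 < Fintype.card (Fin n → A) := Fintype.card_pos
      rw [hN]; exact_mod_cast this
    have hNs : (Fintype.card (Fin (n + 1) → A) : ℝ) = K * N := by
      simp [hN, hK, pow_succ, mul_comm]
    let P : A → A → Set (Fin n → A) := fun a b =>
      {w | (Fin.cons a w : Fin (n + 1) → A) ∈ M ∧ (Fin.cons b w : Fin (n + 1) → A) ∈ M}
    let e := Fin.consEquiv (fun _ : Fin (n + 1) => A)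
    have hcount : (#{q : (Fin (n + 1) → A) × (Fin (n + 1) → A) | Cube M q.1 q.2} : ℝ)
        = ∑ ab : A × A, (#{q : (Fin n → A) × (Fin n → A) | Cube (P ab.1 ab.2) q.1 q.2} : ℝ) := by
      simp only [card_filter, Nat.cast_sum, Nat.cast_ite, Nat.cast_one, Nat.cast_zero]
      rw [Fintype.sum_prod_type, Fintype.sum_prod_type, ← e.sum_comp]
      simp_rw [← e.sum_comp (fun y => if Cube M _ y then (1 : ℝ) else 0), Fintype.sum_prod_type]
      refine sum_congr rfl fun a _ => ?_
      rw [sum_comm]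
      refine sum_congr rfl fun b _ => ?_
      refine sum_congr rfl fun x _ => sum_congr rfl fun y _ => ?_
      exact if_congr (cube_cons M a b x y) rfl rfl
    have hM : (#{x | x ∈ M} : ℝ)
        = ∑ w : Fin n → A, ∑ a : A, if (Fin.cons a w : Fin (n + 1) → A) ∈ M then (1 : ℝ) else 0 := by
      simp only [card_filter, Nat.cast_sum, Nat.cast_ite, Nat.cast_one, Nat.cast_zero]
      rw [← e.sum_comp, Fintype.sum_prod_type, sum_comm]
      rfl
    have hP : ∑ ab : A × A, (#{x | x ∈ P ab.1 ab.2} : ℝ)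
        = ∑ w : Fin n → A, (∑ a : A, if (Fin.cons a w : Fin (n + 1) → A) ∈ M then (1 : ℝ) else 0) ^ 2 := by
      simp only [card_filter, Nat.cast_sum, Nat.cast_ite, Nat.cast_one, Nat.cast_zero]
      rw [sum_comm]
      refine sum_congr rfl fun w _ => ?_
      rw [sq, sum_mul_sum, Fintype.sum_prod_type]
      refine sum_congr rfl fun a _ => sum_congr rfl fun b _ => ?_
      simp only [P, Set.mem_ofPred_eq, ite_and]
      split_ifs <;> simp
    set m : ℝ := (#{x | x ∈ M} : ℝ) with hm
    -- Cauchy–Schwarz over tails: if M has density d, the slices `P a b` have average density at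
    -- least d².
    have hPge : m ^ 2 / N ≤ ∑ ab : A × A, (#{x | x ∈ P ab.1 ab.2} : ℝ) := by
      rw [div_le_iff₀ hN0, hP, hM, mul_comm]
      have := sq_sum_le_card_mul_sum_sq (s := (univ : Finset (Fin n → A)))
        (f := fun w => ∑ a : A, if (Fin.cons a w : Fin (n + 1) → A) ∈ M then (1 : ℝ) else 0)
      rwa [card_univ] at this
    -- Convexity of t ↦ t^(2^n) turns the average d² into d^(2^(n+1)), ready for the induction
    -- hypothesis in each slice.
    have hjensen : (m / (K * N)) ^ 2 ^ (n + 1) * K ^ 2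
        ≤ ∑ ab : A × A, ((#{x | x ∈ P ab.1 ab.2} : ℝ) / N) ^ 2 ^ n := by
      obtain ⟨t, ht⟩ : ∃ t, 2 ^ n = t + 1 := ⟨2 ^ n - 1, by have := Nat.one_le_two_pow (n := n); omega⟩
      have h := pow_sum_div_card_le_sum_pow (s := (univ : Finset (A × A)))
        (f := fun ab => (#{x | x ∈ P ab.1 ab.2} : ℝ) / N) (fun _ _ => by positivity) t
      rw [← ht] at h
      refine le_trans ?_ h
      rw [← Finset.sum_div, card_univ, Fintype.card_prod, Nat.cast_mul, ← hK]
      have h1 : K ^ 2 * (m / (K * N)) ^ 2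
          ≤ (∑ ab : A × A, (#{x | x ∈ P ab.1 ab.2} : ℝ)) / N := by
        rw [le_div_iff₀ hN0]
        refine le_trans (le_of_eq ?_) hPge
        field_simp
      have h2 := pow_le_pow_left₀ (by positivity) h1 (2 ^ n)
      rw [le_div_iff₀ (by positivity)]
      refine le_trans (le_of_eq ?_) h2
      have h3 : (K ^ 2) ^ 2 ^ n = K ^ 2 * (K * K) ^ t := by
        rw [ht, pow_succ' (K ^ 2) t]; ring
      rw [mul_pow (K ^ 2), h3, ← pow_mul, ← pow_succ']
      ring
    rw [hcount, hNs]
    calc (m / (K * N)) ^ 2 ^ (n + 1) * (K * N) ^ 2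
        = ((m / (K * N)) ^ 2 ^ (n + 1) * K ^ 2) * N ^ 2 := by ring
      _ ≤ (∑ ab : A × A, ((#{x | x ∈ P ab.1 ab.2} : ℝ) / N) ^ 2 ^ n) * N ^ 2 := by gcongr
      _ = ∑ ab : A × A, ((#{x | x ∈ P ab.1 ab.2} : ℝ) / N) ^ 2 ^ n * N ^ 2 := by rw [sum_mul]
      _ ≤ _ := sum_le_sum fun ab _ => by
        refine le_of_eq_of_le ?_ (ih (P ab.1 ab.2))
        congr!

open Classical Finset in
/-- Dependent random choice: a dense symmetric relation has a dense neighbourhood in which all but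
a small proportion of the pairs have many common neighbours. -/
theorem exists_hub {Ω : Type*} [Fintype Ω] (G : Ω → Ω → Prop) (hG : ∀ x y, G x y → G y x)
    {p θ : ℝ} (hp : 0 < p) (hθ : 0 < θ) (hΩ : 0 < Fintype.card Ω)
    (hd : p * (Fintype.card Ω : ℝ) ^ 2 ≤ #{q : Ω × Ω | G q.1 q.2}) :
    ∃ U : Finset Ω, (∀ x ∈ U, ∃ y, G x y) ∧ p / 2 * Fintype.card Ω ≤ #U ∧
      (#{q : Ω × Ω | q.1 ∈ U ∧ q.2 ∈ U ∧
          (#{y | G q.1 y ∧ G y q.2} : ℝ) < θ * Fintype.card Ω} : ℝ)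
        ≤ 2 * θ / p ^ 2 * (Fintype.card Ω : ℝ) ^ 2 := by
  set N : ℝ := (Fintype.card Ω : ℝ) with hN
  have hN0 : 0 < N := by rw [hN]; exact_mod_cast hΩ
  let nb : Ω → Finset Ω := fun s => {x | G x s}
  obtain ⟨cod, hcod⟩ : ∃ cod : Ω × Ω → ℝ, ∀ q, (#{y | G q.1 y ∧ G y q.2} : ℝ) = cod q :=
    ⟨_, fun _ => rfl⟩
  simp_rw [hcod]
  let bad : Ω → Finset (Ω × Ω) := fun s => {q | q.1 ∈ nb s ∧ q.2 ∈ nb s ∧ cod q < θ * N}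
  have hnb : ∑ s, (#(nb s) : ℝ) = #{q : Ω × Ω | G q.1 q.2} := by
    simp only [nb, card_filter, Nat.cast_sum, Nat.cast_ite, Nat.cast_one, Nat.cast_zero]
    rw [Fintype.sum_prod_type, sum_comm]
  have hsq : p ^ 2 * N ^ 3 ≤ ∑ s, (#(nb s) : ℝ) ^ 2 := by
    have h := sq_sum_le_card_mul_sum_sq (s := (univ : Finset Ω)) (f := fun s => (#(nb s) : ℝ))
    rw [hnb, card_univ, ← hN] at h
    have h1 := pow_le_pow_left₀ (by positivity) hd 2
    have h2 : N * (p ^ 2 * N ^ 3) ≤ N * ∑ s, (#(nb s) : ℝ) ^ 2 := by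
      refine le_trans (le_of_eq ?_) (h1.trans h)
      ring
    exact le_of_mul_le_mul_left h2 hN0
  -- A pair q with few common neighbours is counted for exactly `cod q` < θN choices of s.
  have hbad : ∑ s, (#(bad s) : ℝ) ≤ θ * N ^ 3 := by
    have h1 : ∑ s, (#(bad s) : ℝ) = ∑ q : Ω × Ω,
        if cod q < θ * N then cod q else 0 := by
      simp only [bad, nb, card_filter _ (univ : Finset (Ω × Ω)), Nat.cast_sum]
      rw [sum_comm]
      refine sum_congr rfl fun q _ => ?_
      split_ifs with hq
      · refine Eq.trans ?_ (hcod q)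
        rw [card_filter, Nat.cast_sum]
        refine sum_congr rfl fun s _ => ?_
        have : (G q.1 s ∧ G q.2 s) ↔ (G q.1 s ∧ G s q.2) :=
          and_congr_right fun _ => ⟨hG _ _, hG _ _⟩
        simp only [mem_filter, mem_univ, true_and, hq, and_true, this]
      · simp [hq]
    rw [h1]
    have h2 : ∀ q ∈ (univ : Finset (Ω × Ω)), (if cod q < θ * N then cod q else 0) ≤ θ * N := by
      intro q _
      split_ifs with h
      · exact h.le
      · positivity
    refine (sum_le_card_nsmul _ _ _ h2).trans (le_of_eq ?_)
    rw [card_univ, Fintype.card_prod, nsmul_eq_mul, Nat.cast_mul]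
    ring
  -- Averaging over s: the weight p²/(2θ) makes the total penalty at most half of the lower bound
  -- p²N³ for the sum of squares, so one s has both a large neighbourhood and few bad pairs.
  obtain ⟨s, -, hs⟩ : ∃ s ∈ (univ : Finset Ω),
      p ^ 2 / 2 * N ^ 2 ≤ (#(nb s) : ℝ) ^ 2 - p ^ 2 / (2 * θ) * #(bad s) := by
    refine exists_le_of_sum_le (by rw [← card_pos, card_univ]; exact hΩ) ?_
    rw [sum_sub_distrib, sum_const, card_univ, nsmul_eq_mul, ← hN,
      ← mul_sum univ (fun s => (#(bad s) : ℝ))]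
    have h3 : p ^ 2 / (2 * θ) * ∑ s, (#(bad s) : ℝ) ≤ p ^ 2 / 2 * N ^ 3 := by
      refine (mul_le_mul_of_nonneg_left hbad (by positivity)).trans (le_of_eq ?_)
      field_simp
    nlinarith
  have hle : (#(nb s) : ℝ) ≤ N := by
    rw [hN]; exact_mod_cast card_le_univ _
  have hb0 : (0 : ℝ) ≤ p ^ 2 / (2 * θ) * #(bad s) := by positivity
  refine ⟨nb s, fun x hx => ⟨s, by simpa [nb] using hx⟩, ?_, ?_⟩
  · by_contra! h
    have : (#(nb s) : ℝ) ^ 2 < (p / 2 * N) ^ 2 := pow_lt_pow_left₀ h (by positivity) (by norm_num)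
    have : 0 < p ^ 2 * N ^ 2 := by positivity
    nlinarith
  · have h1 : p ^ 2 / (2 * θ) * #(bad s) ≤ N ^ 2 := by
      have : (#(nb s) : ℝ) ^ 2 ≤ N ^ 2 := pow_le_pow_left₀ (by positivity) hle 2
      have : 0 ≤ p ^ 2 / 2 * N ^ 2 := by positivity
      linarith
    calc (#(bad s) : ℝ) = 2 * θ / p ^ 2 * (p ^ 2 / (2 * θ) * #(bad s)) := by field_simp
      _ ≤ _ := by gcongr

/-! ### Cycles and matchings in graphs, sequential choice -/

open Finset in
/-- Pósa's argument: for a symmetric relation on a non-empty finite set, there is a cycle (possibly a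
single vertex or an edge) with a vertex that has no neighbours outside the cycle. -/
theorem exists_cycle_of_nonempty {α : Type*} [DecidableEq α] (adj : α → α → Prop)
    (hadj : ∀ a b, adj a b → adj b a) (S : Finset α) (hS : S.Nonempty) :
    ∃ (m : ℕ) (u : ℕ → α), 1 ≤ m ∧ (∀ i < m, u i ∈ S) ∧ Set.InjOn u (Set.Iio m) ∧
      (2 ≤ m → ∀ i < m, adj (u i) (u ((i + 1) % m))) ∧
      ∀ w ∈ S, (∀ i < m, w ≠ u i) → ¬ adj (u 0) w := by
  classical
  let path : ℕ → Prop := fun m => ∃ u : ℕ → α, (∀ i < m, u i ∈ S) ∧ Set.InjOn u (Set.Iio m) ∧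
    ∀ i, i + 1 < m → adj (u i) (u (i + 1))
  have hbound : ∀ m, path m → m ≤ #S := by
    rintro m ⟨u, hu, hinj, -⟩
    have := card_le_card_of_injOn (s := range m) u (fun i hi => hu i (by simpa using hi))
      (by simpa using hinj)
    simpa using this
  have h1 : path 1 := by
    obtain ⟨a, ha⟩ := hS
    refine ⟨fun _ => a, fun _ _ => ha, ?_, fun i hi => by omega⟩
    intro i hi j hj _
    simp only [Set.mem_Iio] at hi hj
    omega
  set l := Nat.findGreatest path #S with hl
  have hpl : path l := Nat.findGreatest_spec (hbound 1 h1) h1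
  have hl1 : 1 ≤ l := Nat.le_findGreatest (hbound 1 h1) h1
  obtain ⟨u, huS, hinj, hchain⟩ := hpl
  have hmax : ∀ w ∈ S, adj (u 0) w → ∃ i < l, w = u i := by
    intro w hw hadjw
    by_contra! hne
    have : path (l + 1) := by
      refine ⟨fun i => if i = 0 then w else u (i - 1), ?_, ?_, ?_⟩
      · intro i hi
        dsimp only
        split_ifs
        · exact hw
        · exact huS _ (by omega)
      · intro i hi j hj hij
        simp only [Set.mem_Iio] at hi hj
        dsimp only at hij
        split_ifs at hij with h h' h'
        · omega
        · exact absurd hij (hne _ (by omega))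
        · exact absurd hij.symm (hne _ (by omega))
        · have := hinj (Set.mem_Iio.2 (by omega)) (Set.mem_Iio.2 (by omega)) hij
          omega
      · intro i hi
        rcases i with _ | i
        · simpa using hadj _ _ hadjw
        · simpa using hchain i (by omega)
    have := Nat.le_findGreatest (hbound _ this) this
    omega
  -- All neighbours of `u 0` lie on the longest path, and the cycle is closed at the last of them.
  -- The value 0 also stands for having no neighbour; the single vertex `u 0` then serves.
  set j := Nat.findGreatest (fun i => i < l ∧ adj (u 0) (u i)) l with hj
  by_cases hj0 : j = 0
  · refine ⟨1, u, le_rfl, fun i hi => huS i (by omega), hinj.mono ?_, fun h => by omega, ?_⟩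
    · exact Set.Iio_subset_Iio hl1
    · intro w hw hne hadjw
      obtain ⟨i, hi, rfl⟩ := hmax w hw hadjw
      have hle : i ≤ j := Nat.le_findGreatest (P := fun i => i < l ∧ adj (u 0) (u i)) hi.le ⟨hi, hadjw⟩
      have : i = 0 := by omega
      exact hne 0 (by omega) (by rw [this])
  · obtain ⟨hjl, hjadj⟩ : j < l ∧ adj (u 0) (u j) :=
      Nat.findGreatest_of_ne_zero (P := fun i => i < l ∧ adj (u 0) (u i)) hj.symm hj0
    refine ⟨j + 1, u, by omega, fun i hi => huS i (by omega), hinj.mono ?_, fun _ i hi => ?_, ?_⟩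
    · exact Set.Iio_subset_Iio (by omega)
    · rcases Nat.lt_or_ge i j with h | h
      · rw [Nat.mod_eq_of_lt (by omega)]
        exact hchain i (by omega)
      · have : i = j := by omega
        rw [this, Nat.mod_self]
        exact hadj _ _ hjadj
    · intro w hw hne hadjw
      obtain ⟨i, hi, rfl⟩ := hmax w hw hadjw
      have hle : i ≤ j := Nat.le_findGreatest (P := fun i => i < l ∧ adj (u 0) (u i)) hi.le ⟨hi, hadjw⟩
      exact hne i (by omega) rfl

open Finset in
/-- A finite set with a symmetric relation splits into disjoint related pairs and a set of pairwise
unrelated elements. -/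
theorem exists_maximal_matching {α : Type*} [DecidableEq α] (adj : α → α → Prop) (S : Finset α) :
    ∃ (P : Finset (α × α)) (R : Finset α), (∀ p ∈ P, p.1 ≠ p.2 ∧ adj p.1 p.2) ∧
      (∀ p ∈ P, ∀ q ∈ P, p ≠ q → Disjoint ({p.1, p.2} : Finset α) {q.1, q.2}) ∧
      (∀ p ∈ P, Disjoint ({p.1, p.2} : Finset α) R) ∧
      R ∪ P.biUnion (fun p => {p.1, p.2}) = S ∧
      ∀ a ∈ R, ∀ b ∈ R, a ≠ b → ¬ adj a b := by
  induction S using Finset.strongInduction with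
  | H S ih =>
    by_cases h : ∃ a ∈ S, ∃ b ∈ S, a ≠ b ∧ adj a b
    · obtain ⟨a, ha, b, hb, hab, hadj⟩ := h
      obtain ⟨P, R, h1, h2, h3, h4, h5⟩ := ih ((S.erase a).erase b)
        ((erase_subset _ _).trans_ssubset (erase_ssubset ha))
      have hdisj : Disjoint ({a, b} : Finset α) (R ∪ P.biUnion (fun p => {p.1, p.2})) := by
        rw [h4, disjoint_left]
        intro x hx hx'
        simp only [mem_insert, mem_singleton, mem_erase] at hx hx'
        tauto
      rw [disjoint_union_right, disjoint_biUnion_right] at hdisj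
      refine ⟨insert (a, b) P, R, ?_, ?_, ?_, ?_, h5⟩
      · intro p hp
        rcases mem_insert.1 hp with rfl | hp
        exacts [⟨hab, hadj⟩, h1 p hp]
      · intro p hp q hq hpq
        rcases mem_insert.1 hp with rfl | hp <;> rcases mem_insert.1 hq with rfl | hq
        · exact absurd rfl hpq
        · exact hdisj.2 q hq
        · exact (hdisj.2 p hp).symm
        · exact h2 p hp q hq hpq
      · intro p hp
        rcases mem_insert.1 hp with rfl | hp
        exacts [hdisj.1, h3 p hp]
      · rw [biUnion_insert, union_left_comm, h4]
        ext x
        simp only [mem_union, mem_insert, mem_singleton, mem_erase]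
        constructor
        · rintro ((rfl | rfl) | h) <;> tauto
        · tauto
    · push Not at h
      exact ⟨∅, S, by simp, by simp, by simp, by simp, h⟩

/-- Sequential choice: if every admissible initial segment can be extended, then there is an
admissible sequence. -/
theorem exists_seq_of_step {Ω : Type*} [Nonempty Ω] (m : ℕ) (R : ℕ → (ℕ → Ω) → Ω → Prop)
    (hR : ∀ j x x' y, (∀ i < j, x i = x' i) → R j x y → R j x' y)
    (step : ∀ j < m, ∀ x : ℕ → Ω, (∀ i < j, R i x (x i)) → ∃ y, R j x y) :
    ∃ x : ℕ → Ω, ∀ i < m, R i x (x i) := by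
  suffices h : ∀ j ≤ m, ∃ x : ℕ → Ω, ∀ i < j, R i x (x i) from h m le_rfl
  intro j
  induction j with
  | zero => exact fun _ => ⟨fun _ => Classical.arbitrary Ω, fun i hi => by omega⟩
  | succ j ih =>
    intro hj
    obtain ⟨x, hx⟩ := ih (by omega)
    obtain ⟨y, hy⟩ := step j (by omega) x hx
    refine ⟨Function.update x j y, fun i hi => ?_⟩
    have hagree : ∀ i' < i, x i' = Function.update x j y i' := fun i' hi' => by
      rw [Function.update_of_ne (by omega)]
    rcases Nat.lt_or_ge i j with h | h
    · rw [Function.update_of_ne (by omega)]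
      exact hR i _ _ _ hagree (hx i h)
    · obtain rfl : i = j := by omega
      rw [Function.update_self]
      exact hR i _ _ _ hagree hy

/-! ### Counting tuples -/

open Classical Finset in
/-- At most `n * |F| * |A| ^ (n - 1)` tuples have an entry in `F`. -/
theorem card_tuples_meeting {A : Type*} [Fintype A] (n : ℕ) (F : Finset A) :
    #{x : Fin n → A | ∃ i, x i ∈ F} * Fintype.card A ≤ n * #F * Fintype.card (Fin n → A) := by
  have h1 : ∀ i : Fin n, #{x : Fin n → A | x i ∈ F} * Fintype.card A
      = #F * Fintype.card (Fin n → A) := by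
    intro i
    have h : ({x : Fin n → A | x i ∈ F} : Finset (Fin n → A))
        = Fintype.piFinset (Function.update (fun _ => univ) i F) := by
      ext x
      simp only [mem_filter, mem_univ, true_and, Fintype.mem_piFinset]
      constructor
      · intro hx j
        by_cases hj : j = i
        · subst hj; simpa using hx
        · simp [Function.update_of_ne hj]
      · intro hx
        simpa using hx i
    rw [h, Fintype.card_piFinset]
    have h2 : ∀ j, #(Function.update (fun _ => (univ : Finset A)) i F j)
        = Function.update (fun _ => Fintype.card A) i (#F) j := by
      intro j
      by_cases hj : j = i
      · subst hj; simp
      · simp [Function.update_of_ne hj]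
    simp_rw [h2]
    rw [prod_update_of_mem (mem_univ i), prod_const, ← erase_eq,
      card_erase_of_mem (mem_univ i), card_univ, Fintype.card_fin, mul_assoc, ← pow_succ,
      Nat.sub_add_cancel (Fin.pos i)]
    simp
  have h2 : ({x : Fin n → A | ∃ i, x i ∈ F} : Finset (Fin n → A))
      ⊆ univ.biUnion fun i => {x : Fin n → A | x i ∈ F} := by
    intro x
    simp
  calc _ ≤ (∑ i : Fin n, #{x : Fin n → A | x i ∈ F}) * Fintype.card A :=
        Nat.mul_le_mul_right _ ((card_le_card h2).trans card_biUnion_le)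
    _ = _ := by
        rw [sum_mul, sum_congr rfl fun i _ => h1 i, sum_const, card_univ, Fintype.card_fin,
          smul_eq_mul, mul_assoc]

open Classical Finset in
/-- If `|A| ≥ 2 n ^ 2`, at least half of the `n`-tuples in `A` are injective. -/
theorem card_le_two_mul_card_injective {A : Type*} [Fintype A] (n : ℕ)
    (h : 2 * n ^ 2 ≤ Fintype.card A) :
    Fintype.card (Fin n → A) ≤ 2 * #{x : Fin n → A | Function.Injective x} := by
  have h1 : #{x : Fin n → A | Function.Injective x} = (Fintype.card A).descFactorial n := by
    rw [← Fintype.card_subtype, Fintype.card_congr (Equiv.subtypeInjectiveEquivEmbedding (Fin n) A),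
      Fintype.card_embedding_eq, Fintype.card_fin]
  rw [h1, Fintype.card_fun, Fintype.card_fin]
  set a := Fintype.card A with ha
  rcases Nat.eq_zero_or_pos n with rfl | hn
  · simp
  have hna : n ≤ a := by nlinarith
  have ha0 : 0 < a := by omega
  have h2 := Nat.pow_sub_le_descFactorial a n
  suffices hh : (a : ℝ) ^ n ≤ 2 * ((a - n : ℕ) : ℝ) ^ n by
    have h3 : a ^ n ≤ 2 * (a - n) ^ n := by exact_mod_cast hh
    have h4 : (a - n) ^ n ≤ (a + 1 - n) ^ n := Nat.pow_le_pow_left (by omega) n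
    omega
  rw [Nat.cast_sub hna]
  have haR : (0 : ℝ) < a := by exact_mod_cast ha0
  have hb : (a : ℝ) - n = a * (1 + -(n / a : ℝ)) := by field_simp; ring
  have hle : (n : ℝ) / a ≤ 1 := by
    rw [div_le_one haR]; exact_mod_cast hna
  -- Bernoulli: (1 - n/a)^n ≥ 1 - n²/a ≥ 1/2.
  have hber := one_add_mul_le_pow (a := -(n / a : ℝ)) (by linarith) n
  have hq : (n : ℝ) * (n / a) ≤ 1 / 2 := by
    rw [← mul_div_assoc, div_le_iff₀ haR]
    have : (2 * (n : ℝ) ^ 2) ≤ a := by exact_mod_cast h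
    nlinarith
  rw [hb, mul_pow]
  have : (0 : ℝ) < (a : ℝ) ^ n := by positivity
  nlinarith

/-! ### Monochromatic covers and tight cycles made of blocks -/

/-- Every edge consisting of `z` and the entries of `x` has colour `c`. -/
def HasColour {V : Type*} {n r : ℕ} (φ : CompleteColouring V (n + 1) r) (c : Fin r) (z : V)
    (x : Fin n → V) : Prop :=
  ∀ e : Set.powersetCard V (n + 1), ((e : Finset V) : Set V) = insert z (Set.range x) → φ e = c

/-- There are at most `q` vertex-disjoint monochromatic tight cycles whose vertices are exactly
those of `Z` and `W`. -/
def Coverable {V : Type*} {k r : ℕ} (φ : CompleteColouring V k r) (Z W : Finset V) (q : ℕ) : Prop :=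
  ∃ 𝒞 : Finset (Hypergraph V), (∀ C ∈ 𝒞, IsTightCycle k C ∧ IsMonochromatic φ C) ∧
    (𝒞 : Set (Hypergraph V)).PairwiseDisjoint Hypergraph.vertexSet ∧
    (⋃ C ∈ 𝒞, C.vertexSet) = (Z : Set V) ∪ W ∧ 𝒞.card ≤ q

theorem Coverable.empty {V : Type*} {k r : ℕ} (φ : CompleteColouring V k r) (q : ℕ) :
    Coverable φ ∅ ∅ q :=
  ⟨∅, by simp, by simp, by simp, by simp⟩

theorem Coverable.of_cycle {V : Type*} {k r : ℕ} {φ : CompleteColouring V k r} {Z W : Finset V}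
    (C : Hypergraph V) (hC : IsTightCycle k C) (hφ : IsMonochromatic φ C)
    (h : C.vertexSet = (Z : Set V) ∪ W) : Coverable φ Z W 1 :=
  ⟨{C}, by simp [hC, hφ], by simp, by simp [h], by simp⟩

open Classical in
theorem Coverable.union {V : Type*} {k r : ℕ} {φ : CompleteColouring V k r}
    {Z₁ Z₂ W₁ W₂ : Finset V} {q₁ q₂ : ℕ} (h₁ : Coverable φ Z₁ W₁ q₁) (h₂ : Coverable φ Z₂ W₂ q₂)
    (h : Disjoint (Z₁ ∪ W₁) (Z₂ ∪ W₂)) : Coverable φ (Z₁ ∪ Z₂) (W₁ ∪ W₂) (q₁ + q₂) := by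
  obtain ⟨𝒞₁, hc₁, hd₁, hu₁, hq₁⟩ := h₁
  obtain ⟨𝒞₂, hc₂, hd₂, hu₂, hq₂⟩ := h₂
  refine ⟨𝒞₁ ∪ 𝒞₂, ?_, ?_, ?_, (Finset.card_union_le _ _).trans (by omega)⟩
  · intro C hC
    rcases Finset.mem_union.1 hC with hC | hC
    exacts [hc₁ C hC, hc₂ C hC]
  · rw [Finset.coe_union, Set.pairwiseDisjoint_union]
    refine ⟨hd₁, hd₂, fun C hC D hD _ => ?_⟩
    have hC' : C.vertexSet ⊆ (Z₁ : Set V) ∪ W₁ := hu₁ ▸ Set.subset_biUnion_of_mem hC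
    have hD' : D.vertexSet ⊆ (Z₂ : Set V) ∪ W₂ := hu₂ ▸ Set.subset_biUnion_of_mem hD
    refine Set.disjoint_of_subset hC' hD' ?_
    exact_mod_cast h
  · have : (⋃ C ∈ 𝒞₁ ∪ 𝒞₂, C.vertexSet) = (⋃ C ∈ 𝒞₁, C.vertexSet) ∪ ⋃ C ∈ 𝒞₂, C.vertexSet := by
      simp only [Finset.mem_union]
      exact Set.biUnion_union _ _ _
    rw [this, hu₁, hu₂]
    push_cast
    exact Set.union_union_union_comm _ _ _ _

/-- A vertex `z` and `n` further vertices form a degenerate cycle. -/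
theorem coverable_singleton {V : Type*} {n r : ℕ} (hr : 1 ≤ r) (φ : CompleteColouring V (n + 1) r)
    (z : V) (W : Finset V) (hW : W.card = n) : Coverable φ {z} W 1 := by
  classical
  have hcard : (insert z W).card ≤ n + 1 := (Finset.card_insert_le _ _).trans (by omega)
  refine Coverable.of_cycle
    ⟨(insert z W : Finset V), {e | e ⊆ ((insert z W : Finset V) : Set V) ∧ e.encard = (n + 1 : ℕ)},
      fun e he => he.1⟩ (Or.inr ⟨?_, ?_, rfl⟩) ?_ ?_
  · simp
  · rw [Set.encard_coe_eq_coe_finsetCard]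
    exact_mod_cast hcard
  · by_cases h : (insert z W).card = n + 1
    · refine ⟨φ ⟨insert z W, h⟩, fun e he => ?_⟩
      congr 1
      refine Subtype.ext (Finset.eq_of_subset_of_card_le (Finset.coe_subset.1 he.1) ?_)
      exact h.le.trans (Set.powersetCard.card_eq e).ge
    · refine ⟨⟨0, hr⟩, fun e he => absurd ?_ h⟩
      have := Finset.card_le_card (Finset.coe_subset.1 he.1)
      rw [Set.powersetCard.card_eq] at this
      omega
  · simp

/-- The sequence `z 0, w 0 0, …, w 0 (n - 1), z 1, w 1 0, …`. -/
def blockSeq {V : Type*} {n : ℕ} (z : ℕ → V) (w : ℕ → Fin n → V) (a : ℕ) : V :=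
  if h : a % (n + 1) = 0 then z (a / (n + 1))
  else w (a / (n + 1)) ⟨a % (n + 1) - 1, by have := Nat.mod_lt a (Nat.add_one_pos n); omega⟩

theorem blockSeq_zero {V : Type*} {n : ℕ} (z : ℕ → V) (w : ℕ → Fin n → V) (q : ℕ) :
    blockSeq z w (q * (n + 1)) = z q := by
  unfold blockSeq
  rw [dif_pos (Nat.mul_mod_left _ _), Nat.mul_div_cancel _ (Nat.add_one_pos n)]

theorem blockSeq_succ {V : Type*} {n : ℕ} (z : ℕ → V) (w : ℕ → Fin n → V) (q : ℕ) (i : Fin n) :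
    blockSeq z w (q * (n + 1) + (i + 1)) = w q i := by
  unfold blockSeq
  have h1 : (q * (n + 1) + (i + 1)) % (n + 1) = i + 1 := by
    rw [mul_comm, Nat.mul_add_mod, Nat.mod_eq_of_lt (by omega)]
  have h2 : (q * (n + 1) + (i + 1)) / (n + 1) = q := by
    rw [mul_comm, Nat.mul_add_div (Nat.add_one_pos n), Nat.div_eq_of_lt (by omega), add_zero]
  rw [dif_neg (by omega)]
  congr 1
  ext
  simp only [h1]
  omega

theorem exists_block_eq (n a : ℕ) :
    (∃ q, a = q * (n + 1)) ∨ ∃ q, ∃ i : Fin n, a = q * (n + 1) + (i + 1) := by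
  have h := Nat.div_add_mod' a (n + 1)
  have h1 := Nat.mod_lt a (Nat.add_one_pos n)
  rcases Nat.eq_zero_or_pos (a % (n + 1)) with h0 | h0
  · exact Or.inl ⟨a / (n + 1), by omega⟩
  · exact Or.inr ⟨a / (n + 1), ⟨a % (n + 1) - 1, by omega⟩, by
      simp only; omega⟩

theorem block_add_mod {n m q s : ℕ} (hm : 0 < m) (hs : s < n + 1) :
    (q * (n + 1) + s) % (m * (n + 1)) = q % m * (n + 1) + s := by
  have h : q * (n + 1) + s = (q % m * (n + 1) + s) + m * (n + 1) * (q / m) := by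
    conv_lhs => rw [← Nat.div_add_mod q m]
    ring
  rw [h, Nat.add_mul_mod_self_left, Nat.mod_eq_of_lt]
  have : q % m + 1 ≤ m := Nat.mod_lt q hm
  nlinarith [Nat.mul_le_mul_right (n + 1) this]

/-- Blocks consisting of a vertex followed by `n` vertices form a monochromatic tight cycle if all
edges mixing two consecutive blocks have the same colour. -/
theorem coverable_blocks {V : Type*} {n r : ℕ} (φ : CompleteColouring V (n + 1) r) (c : Fin r)
    (m : ℕ) (hm : 2 ≤ m) (z : ℕ → V) (w : ℕ → Fin n → V) (hz : Set.InjOn z (Set.Iio m))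
    (hw : ∀ j < m, ∀ j' < m, ∀ i i', w j i = w j' i' → j = j' ∧ i = i')
    (hzw : ∀ j < m, ∀ j' < m, ∀ i, z j ≠ w j' i)
    (hc : ∀ j < m, ∀ l ≤ n, HasColour φ c (z ((j + 1) % m))
      (fun i => if (i : ℕ) < l then w ((j + 1) % m) i else w j i))
    (Z W : Finset V) (hZ : (Z : Set V) = z '' Set.Iio m)
    (hW : (W : Set V) = ⋃ j ∈ Set.Iio m, Set.range (w j)) : Coverable φ Z W 1 := by
  set M := m * (n + 1) with hM
  have hM0 : 0 < M := by positivity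
  have hblock : ∀ q s, q * (n + 1) + s < M → q < m := by
    intro q s h
    by_contra! hq
    nlinarith [Nat.mul_le_mul_right (n + 1) hq]
  have hinj : Set.InjOn (blockSeq z w) (Set.Iio M) := by
    intro a ha b hb hab
    simp only [Set.mem_Iio] at ha hb
    rcases exists_block_eq n a with ⟨q, rfl⟩ | ⟨q, i, rfl⟩ <;>
      rcases exists_block_eq n b with ⟨q', rfl⟩ | ⟨q', i', rfl⟩
    · rw [blockSeq_zero, blockSeq_zero] at hab
      rw [hz (hblock q 0 ha) (hblock q' 0 hb) hab]
    · rw [blockSeq_zero, blockSeq_succ] at hab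
      exact absurd hab (hzw _ (hblock q 0 ha) _ (hblock _ _ hb) _)
    · rw [blockSeq_zero, blockSeq_succ] at hab
      exact absurd hab.symm (hzw _ (hblock q' 0 hb) _ (hblock _ _ ha) _)
    · rw [blockSeq_succ, blockSeq_succ] at hab
      obtain ⟨rfl, rfl⟩ := hw _ (hblock _ _ ha) _ (hblock _ _ hb) _ _ hab
      rfl
  let C : Hypergraph V :=
    { vertexSet := blockSeq z w '' Set.Iio M
      edgeSet := {e | ∃ i < M, e = (fun j => blockSeq z w ((i + j) % M)) '' Set.Iio (n + 1)}
      subset_vertexSet_of_mem_edgeSet' := by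
        rintro e ⟨i, -, rfl⟩ _ ⟨j, -, rfl⟩
        exact ⟨_, Nat.mod_lt _ hM0, rfl⟩ }
  refine Coverable.of_cycle C (Or.inl ⟨M, blockSeq z w, ?_, hinj, rfl, rfl⟩) ⟨c, ?_⟩ ?_
  · rw [hM]; nlinarith
  · rintro e ⟨a, ha, he⟩
    -- With the offset s in 1, …, n + 1 instead of 0, …, n, the only z in the window is that of
    -- block q + 1. It is preceded by the end of the tuple of block q, and followed by the first s -
    -- 1 entries of the next tuple. Adding M avoids a negative q when a = 0.
    obtain ⟨q, s, hs1, hs2, hqs⟩ : ∃ q s, 1 ≤ s ∧ s ≤ n + 1 ∧ a + M = q * (n + 1) + s := by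
      have h := Nat.div_add_mod' (a + M - 1) (n + 1)
      have h1 := Nat.mod_lt (a + M - 1) (Nat.add_one_pos n)
      exact ⟨(a + M - 1) / (n + 1), (a + M - 1) % (n + 1) + 1, by omega, by omega, by omega⟩
    have hm0 : 0 < m := by omega
    have hq1 : (q + 1) % m = (q % m + 1) % m := by rw [Nat.mod_add_mod]
    refine hc (q % m) (Nat.mod_lt _ hm0) (s - 1) (by omega) e ?_
    set x : Fin n → V := fun i => if (i : ℕ) < s - 1 then w ((q % m + 1) % m) i else w (q % m) i
      with hx
    have hsub : ((e : Finset V) : Set V) ⊆ insert (z ((q % m + 1) % m)) (Set.range x) := by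
      rw [he]
      rintro _ ⟨t, ht, rfl⟩
      simp only [Set.mem_Iio] at ht
      have hat : (a + t) % M = (q * (n + 1) + (s + t)) % M := by
        rw [← add_assoc, ← hqs, add_right_comm, Nat.add_mod_right]
      dsimp only
      rw [hat]
      rcases Nat.lt_trichotomy (s + t) (n + 1) with hlt | heq | hgt
      · right
        refine ⟨⟨s + t - 1, by omega⟩, ?_⟩
        have h1 : s + t = (⟨s + t - 1, by omega⟩ : Fin n).val + 1 := by simp only; omega
        rw [hM, block_add_mod hm0 hlt]
        conv_rhs => rw [h1]
        rw [blockSeq_succ, hx]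
        simp only
        rw [if_neg (by omega)]
      · left
        have h1 : q * (n + 1) + (s + t) = (q + 1) * (n + 1) + 0 := by rw [heq]; ring
        rw [h1, hM, block_add_mod hm0 (by omega), add_zero, blockSeq_zero, hq1]
      · right
        refine ⟨⟨s + t - (n + 1) - 1, by omega⟩, ?_⟩
        have h1 : q * (n + 1) + (s + t)
            = (q + 1) * (n + 1) + ((⟨s + t - (n + 1) - 1, by omega⟩ : Fin n).val + 1) := by
          simp only [add_mul]
          omega
        rw [h1, hM, block_add_mod hm0 (by simp only; omega), blockSeq_succ, hq1, hx]
        simp only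
        rw [if_pos (by omega)]
    refine Set.eq_of_subset_of_ncard_le hsub ?_ ((Set.finite_range x).insert _)
    rw [Set.ncard_coe_finset, Set.powersetCard.card_eq]
    refine (Set.ncard_insert_le _ _).trans (Nat.add_le_add_right ?_ 1)
    rw [← Set.image_univ]
    refine (Set.ncard_image_le Set.finite_univ).trans ?_
    rw [Set.ncard_univ]
    simp
  · rw [hZ, hW]
    ext v
    simp only [C, Set.mem_image, Set.mem_Iio, Set.mem_union, Set.mem_iUnion, Set.mem_range,
      exists_prop]
    constructor
    · rintro ⟨a, ha, rfl⟩
      rcases exists_block_eq n a with ⟨q, rfl⟩ | ⟨q, i, rfl⟩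
      · exact Or.inl ⟨q, hblock q 0 ha, (blockSeq_zero z w q).symm⟩
      · exact Or.inr ⟨q, hblock _ _ ha, i, (blockSeq_succ z w q i).symm⟩
    · rintro (⟨q, hq, rfl⟩ | ⟨q, hq, i, rfl⟩)
      · refine ⟨q * (n + 1), ?_, blockSeq_zero z w q⟩
        rw [hM]; exact Nat.mul_lt_mul_of_pos_right hq (Nat.add_one_pos n)
      · refine ⟨q * (n + 1) + (i + 1), ?_, blockSeq_succ z w q i⟩
        have : (q + 1) * (n + 1) ≤ m * (n + 1) := Nat.mul_le_mul_right _ hq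
        rw [hM]; have := i.2; nlinarith

/-! ### Linking tuples around a cycle of hubs -/

open Classical Finset in
theorem card_tuples_meeting_le {A : Type*} [Fintype A] [Nonempty A] {n : ℕ} {F : Finset A} {τ : ℝ}
    (h : (n : ℝ) * #F ≤ τ * Fintype.card A) :
    (#{x : Fin n → A | ∃ i, x i ∈ F} : ℝ) ≤ τ * Fintype.card (Fin n → A) := by
  have hA : (0 : ℝ) < Fintype.card A := by exact_mod_cast Fintype.card_pos
  have h1 : (#{x : Fin n → A | ∃ i, x i ∈ F} : ℝ) * Fintype.card A
      ≤ n * #F * Fintype.card (Fin n → A) := by exact_mod_cast card_tuples_meeting n F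
  have h2 : (n : ℝ) * #F * Fintype.card (Fin n → A)
      ≤ τ * Fintype.card A * Fintype.card (Fin n → A) := by gcongr
  refine le_of_mul_le_mul_right (h1.trans (h2.trans (le_of_eq ?_))) hA
  ring

open Classical in
/-- The number of tuples forming a cube in `M` with both `x` and `y`. -/
noncomputable def codegree {A : Type*} [Fintype A] {n : ℕ} (M : Set (Fin n → A))
    (x y : Fin n → A) : ℕ :=
  (Finset.univ.filter fun v => Cube M x v ∧ Cube M v y).card

/-- `x` and `y` lie in `U` but are linked by few cubes of `M`. -/
def BadPair {A : Type*} [Fintype A] {n : ℕ} (M : Set (Fin n → A)) (U : Finset (Fin n → A)) (θ : ℝ)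
    (x y : Fin n → A) : Prop :=
  x ∈ U ∧ y ∈ U ∧ (codegree M x y : ℝ) < θ * Fintype.card (Fin n → A)

-- Markov's inequality: each heavy x contributes more than lam · |Ω| pairs. It lets a greedy choice
-- avoid the tuples that are bad with too many others.
open Classical Finset in
theorem card_heavy_le {Ω : Type*} [Fintype Ω] (B : Ω → Ω → Prop) {lam μ : ℝ} (hl : 0 < lam)
    (hΩ : 0 < Fintype.card Ω)
    (hB : (#{q : Ω × Ω | B q.1 q.2} : ℝ) ≤ lam * μ * (Fintype.card Ω : ℝ) ^ 2) :
    (#{x | lam * Fintype.card Ω < #{y | B x y}} : ℝ) ≤ μ * Fintype.card Ω := by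
  have hN : (0 : ℝ) < Fintype.card Ω := by exact_mod_cast hΩ
  set H : Finset Ω := {x | lam * Fintype.card Ω < #{y | B x y}} with hH
  have h1 : (#{q : Ω × Ω | B q.1 q.2} : ℝ) = ∑ x, (#{y | B x y} : ℝ) := by
    simp only [card_filter, Nat.cast_sum, Nat.cast_ite, Nat.cast_one, Nat.cast_zero]
    rw [Fintype.sum_prod_type]
  have h2 : #H * (lam * Fintype.card Ω) ≤ ∑ x ∈ H, (#{y | B x y} : ℝ) := by
    rw [← nsmul_eq_mul]
    refine card_nsmul_le_sum _ _ _ fun x hx => ?_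
    rw [hH, mem_filter] at hx
    exact hx.2.le
  have h3 : ∑ x ∈ H, (#{y | B x y} : ℝ) ≤ ∑ x, (#{y | B x y} : ℝ) :=
    sum_le_sum_of_subset_of_nonneg (subset_univ _) fun _ _ _ => by positivity
  have h4 : (lam * Fintype.card Ω) * #H ≤ (lam * Fintype.card Ω) * (μ * Fintype.card Ω) := by
    nlinarith
  exact le_of_mul_le_mul_left h4 (by positivity)

open Classical Finset in
/-- Given a cyclic sequence of hubs such that consecutive ones have a large intersection, there are
disjoint tuples, alternately in these intersections and arbitrary, such that consecutive ones form
cubes. -/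
theorem exists_cyclic_tuples {A : Type*} [Fintype A] [Nonempty A] {n m : ℕ} (hm : 2 ≤ m)
    (M : ℕ → Set (Fin n → A)) (U : ℕ → Finset (Fin n → A)) {p θ : ℝ} (hp : 0 < p) (hθ : 0 < θ)
    (hθp : θ ≤ p ^ 2 / 16)
    (hinter : ∀ i < m, p ^ 2 / 8 * Fintype.card (Fin n → A) ≤
      #{x | x ∈ U i ∧ x ∈ U ((i + 1) % m)})
    (hbad : ∀ i < m, (#{q : (Fin n → A) × (Fin n → A) | BadPair (M i) (U i) θ q.1 q.2} : ℝ)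
      ≤ p ^ 4 / 2 ^ 12 * (Fintype.card (Fin n → A) : ℝ) ^ 2)
    (hUM : ∀ i < m, ∀ x ∈ U i, x ∈ M i) (hM : ∀ i < m, ∀ x ∈ M i, Function.Injective x)
    (F : Finset A) (hF : (n : ℝ) * (#F + 2 * m * n) ≤ θ / 2 * Fintype.card A) :
    ∃ w : ℕ → Fin n → A,
      (∀ j < 2 * m, ∀ j' < 2 * m, ∀ i i', w j i = w j' i' → j = j' ∧ i = i') ∧
      (∀ j < 2 * m, ∀ i, w j i ∉ F) ∧
      ∀ i < m, Cube (M i) (w (2 * i)) (w (2 * i + 1)) ∧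
        Cube (M ((i + 1) % m)) (w (2 * i + 1)) (w (2 * ((i + 1) % m))) := by
  set N : ℝ := (Fintype.card (Fin n → A) : ℝ) with hN
  have hN' : 0 < Fintype.card (Fin n → A) := Fintype.card_pos
  have hN0 : 0 < N := by rw [hN]; exact_mod_cast hN'
  let verts : ℕ → (ℕ → Fin n → A) → Finset A := fun j x =>
    (range j).biUnion fun t => univ.image (x t)
  have hverts : ∀ j x, #(verts j x) ≤ j * n := by
    intro j x
    refine card_biUnion_le.trans ?_
    refine (sum_le_card_nsmul _ _ n fun t _ => ?_).trans (by simp)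
    exact card_image_le.trans (by simp)
  have hmem : ∀ j x t i, t < j → x t i ∈ verts j x := by
    intro j x t i ht
    simp only [verts, mem_biUnion, mem_range, mem_image, mem_univ, true_and]
    exact ⟨t, ht, i, rfl⟩
  have hagree : ∀ j (x x' : ℕ → Fin n → A), (∀ i < j, x i = x' i) → verts j x = verts j x' := by
    intro j x x' h
    refine biUnion_congr rfl fun t ht => ?_
    rw [h t (mem_range.1 ht)]
  have hhit : ∀ G : Finset A, #G ≤ #F + 2 * m * n →
      (#{x : Fin n → A | ∃ i, x i ∈ G} : ℝ) ≤ θ / 2 * N := by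
    intro G hG
    refine card_tuples_meeting_le (le_trans ?_ hF)
    have : (#G : ℝ) ≤ #F + 2 * m * n := by exact_mod_cast hG
    gcongr
  let B : ℕ → (Fin n → A) → (Fin n → A) → Prop := fun t => BadPair (M t) (U t) θ
  let light : ℕ → (Fin n → A) → Prop := fun t x => (#{y | B t x y} : ℝ) ≤ p ^ 2 / 64 * N
  have hheavy : ∀ t < m, (#{x | ¬ light t x} : ℝ) ≤ p ^ 2 / 64 * N := by
    intro t ht
    have h := card_heavy_le (B t) (lam := p ^ 2 / 64) (μ := p ^ 2 / 64) (by positivity) hN'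
      ((hbad t ht).trans (le_of_eq (by rw [← hN]; ring)))
    simpa only [light, not_le] using h
  -- The new tuple must be good with its predecessor in hub j and with `x 0` in hub 0. Lightness in
  -- hub j + 1 keeps the next choice possible; lightness in hub 0, needed of `x 0`, allows the cycle
  -- to be closed.
  obtain ⟨x, hx⟩ := exists_seq_of_step m
    (fun j x y => (y ∈ U j ∩ U ((j + 1) % m)) ∧ (∀ i, y i ∉ F ∪ verts j x) ∧
      light ((j + 1) % m) y ∧ light 0 y ∧ (0 < j → ¬ B j (x (j - 1)) y ∧ ¬ B 0 (x 0) y))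
    (by
      intro j x x' y h ⟨h1, h2, h3, h4, h5⟩
      refine ⟨h1, ?_, h3, h4, fun hj => ?_⟩
      · rw [← hagree j x x' h]; exact h2
      · rw [← h 0 hj, ← h (j - 1) (by omega)]; exact h5 hj)
    (by
      intro j hj x hx
      have hbadj : 0 < j → (#{y | B j (x (j - 1)) y} : ℝ) ≤ p ^ 2 / 64 * N := by
        intro hj0
        have := (hx (j - 1) (by omega)).2.2.1
        rwa [Nat.sub_add_cancel hj0, Nat.mod_eq_of_lt hj] at this
      have hbad0 : 0 < j → (#{y | B 0 (x 0) y} : ℝ) ≤ p ^ 2 / 64 * N :=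
        fun hj0 => (hx 0 hj0).2.2.2.1
      have hG : #(F ∪ verts j x) ≤ #F + 2 * m * n := by
        refine (card_union_le _ _).trans (Nat.add_le_add_left ((hverts j x).trans ?_) _)
        exact Nat.mul_le_mul_right _ (by omega)
      let E : Finset (Fin n → A) := ({y | ∃ i, y i ∈ F ∪ verts j x} : Finset (Fin n → A)) ∪
        (({y | ¬ light ((j + 1) % m) y} : Finset (Fin n → A)) ∪
        (({y | ¬ light 0 y} : Finset (Fin n → A)) ∪
        (({y | 0 < j ∧ B j (x (j - 1)) y} : Finset (Fin n → A)) ∪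
          ({y | 0 < j ∧ B 0 (x 0) y} : Finset (Fin n → A)))))
      have hpos : 0 < p ^ 2 * N := by positivity
      have e1 := hhit _ hG
      have e2 := hheavy ((j + 1) % m) (Nat.mod_lt _ (by omega))
      have e3 := hheavy 0 (by omega)
      have e4 : (#{y | 0 < j ∧ B j (x (j - 1)) y} : ℝ) ≤ p ^ 2 / 64 * N := by
        by_cases hj0 : 0 < j
        · simpa only [hj0, true_and] using hbadj hj0
        · simp only [hj0, false_and, filter_false, card_empty, Nat.cast_zero]; positivity
      have e5 : (#{y | 0 < j ∧ B 0 (x 0) y} : ℝ) ≤ p ^ 2 / 64 * N := by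
        by_cases hj0 : 0 < j
        · simpa only [hj0, true_and] using hbad0 hj0
        · simp only [hj0, false_and, filter_false, card_empty, Nat.cast_zero]; positivity
      -- The excluded density is at most θ/2 + 4 · p²/64 ≤ 3p²/32, below p²/8.
      have hE : (#E : ℝ) < #(U j ∩ U ((j + 1) % m)) := by
        have c1 : (#E : ℝ) ≤ #{y : Fin n → A | ∃ i, y i ∈ F ∪ verts j x} +
            (#{y | ¬ light ((j + 1) % m) y} + (#{y | ¬ light 0 y} +
            (#{y | 0 < j ∧ B j (x (j - 1)) y} + #{y | 0 < j ∧ B 0 (x 0) y}))) := by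
          norm_cast
          refine (card_union_le _ _).trans (Nat.add_le_add_left ?_ _)
          refine (card_union_le _ _).trans (Nat.add_le_add_left ?_ _)
          refine (card_union_le _ _).trans (Nat.add_le_add_left ?_ _)
          exact card_union_le _ _
        have c2 : p ^ 2 / 8 * N ≤ #(U j ∩ U ((j + 1) % m)) := by
          refine (hinter j hj).trans_eq ?_
          congr 2
          ext v
          simp
        nlinarith
      obtain ⟨y, hy, hyE⟩ := exists_mem_notMem_of_card_lt_card (Nat.cast_lt.1 hE)
      simp only [E, mem_union (s := filter _ _), mem_filter, mem_univ, true_and, not_or, not_not,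
        not_exists, not_and] at hyE
      exact ⟨y, hy, hyE.1, hyE.2.1, hyE.2.2.1, fun hj0 => ⟨hyE.2.2.2.1 hj0, hyE.2.2.2.2 hj0⟩⟩)
  have hxU : ∀ i < m, x i ∈ U i ∧ x i ∈ U ((i + 1) % m) := fun i hi => by
    simpa using (hx i hi).1
  have hlink : ∀ i < m, θ * N ≤
      #{v | Cube (M ((i + 1) % m)) (x i) v ∧ Cube (M ((i + 1) % m)) v (x ((i + 1) % m))} := by
    intro i hi
    rcases Nat.lt_or_ge (i + 1) m with h | h
    · rw [Nat.mod_eq_of_lt h]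
      have h1 := ((hx (i + 1) h).2.2.2.2 (Nat.succ_pos _)).1
      have h2 := (hxU i hi).2
      rw [Nat.mod_eq_of_lt h] at h2
      by_contra! hlt
      exact h1 ⟨h2, (hxU (i + 1) h).1, hlt⟩
    · obtain rfl : m = i + 1 := by omega
      rw [Nat.mod_self]
      have h1 := ((hx i (by omega)).2.2.2.2 (by omega)).2
      have h2 := (hxU i (by omega)).2
      rw [Nat.mod_self] at h2
      by_contra! hlt
      refine h1 ⟨(hxU 0 (by omega)).1, h2, lt_of_le_of_lt (Nat.cast_le.2 (card_le_card ?_)) hlt⟩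
      intro v hv
      simp only [mem_filter, mem_univ, true_and] at hv ⊢
      exact ⟨hv.2.symm, hv.1.symm⟩
  -- Inside hub j + 1, `y j` joins `x j` to `x (j + 1)`: there are θN candidates, and at most half
  -- as many meet forbidden or used vertices.
  obtain ⟨y, hy⟩ := exists_seq_of_step m
    (fun j ys v => (Cube (M ((j + 1) % m)) (x j) v ∧ Cube (M ((j + 1) % m)) v (x ((j + 1) % m))) ∧
      ∀ i, v i ∉ F ∪ (verts m x ∪ verts j ys))
    (by
      intro j ys ys' v h ⟨h1, h2⟩
      rw [← hagree j ys ys' h]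
      exact ⟨h1, h2⟩)
    (by
      intro j hj ys _
      have hG : #(F ∪ (verts m x ∪ verts j ys)) ≤ #F + 2 * m * n := by
        have h1 := card_union_le F (verts m x ∪ verts j ys)
        have h2 := card_union_le (verts m x) (verts j ys)
        have h3 := hverts m x
        have h4 := hverts j ys
        have h5 : j * n ≤ m * n := Nat.mul_le_mul_right _ hj.le
        have h6 : 2 * m * n = m * n + m * n := by ring
        omega
      have h1 := hhit _ hG
      have h2 := hlink j hj
      have h3 : 0 < θ * N := by positivity
      have h4 : (#{v : Fin n → A | ∃ i, v i ∈ F ∪ (verts m x ∪ verts j ys)} : ℝ) <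
        #{v | Cube (M ((j + 1) % m)) (x j) v ∧ Cube (M ((j + 1) % m)) v (x ((j + 1) % m))} := by
        linarith
      obtain ⟨v, hv, hvE⟩ := exists_mem_notMem_of_card_lt_card (Nat.cast_lt.1 h4)
      simp only [mem_filter, mem_univ, true_and, not_exists] at hv hvE
      exact ⟨v, hv, hvE⟩)
  have hyx : ∀ i < m, ∀ j < m, ∀ a b, y i a ≠ x j b := by
    intro i hi j hj a b h
    have := (hy i hi).2 a
    rw [h] at this
    exact this (mem_union_right _ (mem_union_left _ (hmem m x j b hj)))
  have hxx : ∀ i < m, ∀ j < m, ∀ a b, x i a = x j b → i = j ∧ a = b := by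
    intro i hi j hj a b h
    rcases Nat.lt_trichotomy i j with hij | rfl | hij
    · exact absurd (mem_union_right _ (h ▸ hmem j x i a hij)) ((hx j hj).2.1 b)
    · exact ⟨rfl, hM i hi _ (hUM i hi _ (hxU i hi).1) h⟩
    · exact absurd (mem_union_right _ (h ▸ hmem i x j b hij)) ((hx i hi).2.1 a)
  have hyM : ∀ i < m, Function.Injective (y i) := fun i hi =>
    hM _ (Nat.mod_lt _ (by omega)) _ (hy i hi).1.2.left_mem
  have hyy : ∀ i < m, ∀ j < m, ∀ a b, y i a = y j b → i = j ∧ a = b := by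
    intro i hi j hj a b h
    rcases Nat.lt_trichotomy i j with hij | rfl | hij
    · exact absurd (mem_union_right _ (mem_union_right _ (h ▸ hmem j y i a hij))) ((hy j hj).2 b)
    · exact ⟨rfl, hyM i hi h⟩
    · exact absurd (mem_union_right _ (mem_union_right _ (h ▸ hmem i y j b hij))) ((hy i hi).2 a)
  have hpred : ∀ i < m, (((i + m - 1) % m) + 1) % m = i ∧ (i + m - 1) % m < m := by
    intro i hi
    rw [Nat.mod_add_mod, Nat.sub_add_cancel (by omega), Nat.add_mod_right, Nat.mod_eq_of_lt hi]
    exact ⟨rfl, Nat.mod_lt _ (by omega)⟩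
  have hsucc : ∀ i < m, (((i + 1) % m) + m - 1) % m = i := by
    intro i hi
    rcases Nat.lt_or_ge (i + 1) m with h | h
    · rw [Nat.mod_eq_of_lt h, show i + 1 + m - 1 = i + m by omega, Nat.add_mod_right,
        Nat.mod_eq_of_lt hi]
    · obtain rfl : m = i + 1 := by omega
      rw [Nat.mod_self, Nat.mod_eq_of_lt (by omega)]
      omega
  -- The cyclic order is y (i - 1), x i, y i, x (i + 1), …, since `y (i - 1)` is the tuple belonging
  -- to hub i.
  refine ⟨fun j => if j % 2 = 0 then y ((j / 2 + m - 1) % m) else x (j / 2), ?_, ?_, ?_⟩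
  · intro j hj j' hj' a b h
    have hjm : j / 2 < m := by omega
    have hjm' : j' / 2 < m := by omega
    dsimp only at h
    split_ifs at h with h1 h2 h2
    · obtain ⟨h3, h4⟩ := hyy _ (hpred _ hjm).2 _ (hpred _ hjm').2 _ _ h
      refine ⟨?_, h4⟩
      have h5 := (hpred _ hjm).1
      rw [h3, (hpred _ hjm').1] at h5
      omega
    · exact absurd h (hyx _ (hpred _ hjm).2 _ hjm' _ _)
    · exact absurd h.symm (hyx _ (hpred _ hjm').2 _ hjm _ _)
    · obtain ⟨h3, h4⟩ := hxx _ hjm _ hjm' _ _ h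
      exact ⟨by omega, h4⟩
  · intro j hj a
    have hjm : j / 2 < m := by omega
    dsimp only
    split_ifs
    · exact fun h => (hy _ (hpred _ hjm).2).2 a (mem_union_left _ h)
    · exact fun h => (hx _ hjm).2.1 a (mem_union_left _ h)
  · intro i hi
    have d1 : 2 * i / 2 = i := by omega
    have d2 : (2 * i + 1) / 2 = i := by omega
    have d3 : 2 * ((i + 1) % m) / 2 = (i + 1) % m := by omega
    have d4 : ¬ (2 * i + 1) % 2 = 0 := by omega
    have d5 : 2 * i % 2 = 0 := by omega
    have d6 : 2 * ((i + 1) % m) % 2 = 0 := by omega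
    simp only [d1, d2, d3, d4, d5, d6, if_true, if_false, hsucc i hi]
    refine ⟨?_, (hy i hi).1.1⟩
    have := (hy _ (hpred i hi).2).1.2
    rwa [(hpred i hi).1] at this

/-! ### Robust covers and how they combine -/

/-- Whenever `F` is a set of forbidden vertices that is not too large, `Z` and `n * |Z|` vertices of
`X` outside `F` are covered by at most `q` disjoint monochromatic tight cycles. -/
def RobustlyCoverable {V : Type*} {n r : ℕ} (φ : CompleteColouring V (n + 1) r) (X : Finset V)
    (f : ℕ) (Z : Finset V) (q : ℕ) : Prop :=
  ∀ F : Finset V, F.card + n * Z.card ≤ f →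
    ∃ W ⊆ X, Disjoint W F ∧ W.card = n * Z.card ∧ Coverable φ Z W q

section RobustlyCoverable

variable {V : Type*} {n r f : ℕ} {φ : CompleteColouring V (n + 1) r} {X : Finset V}

theorem RobustlyCoverable.mono {Z : Finset V} {q q' : ℕ} (h : RobustlyCoverable φ X f Z q)
    (hq : q ≤ q') : RobustlyCoverable φ X f Z q' := by
  intro F hF
  obtain ⟨W, h1, h2, h3, 𝒞, h4, h5, h6, h7⟩ := h F hF
  exact ⟨W, h1, h2, h3, 𝒞, h4, h5, h6, h7.trans hq⟩

theorem RobustlyCoverable.empty (q : ℕ) : RobustlyCoverable φ X f ∅ q :=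
  fun _ _ => ⟨∅, by simp, by simp, by simp, Coverable.empty φ q⟩

-- The vertices used for Z₁ become forbidden for Z₂. The budget f counts n |Z| along with |F|
-- precisely so that this is affordable.
open Classical in
theorem RobustlyCoverable.union {Z₁ Z₂ : Finset V} {q₁ q₂ : ℕ}
    (h₁ : RobustlyCoverable φ X f Z₁ q₁) (h₂ : RobustlyCoverable φ X f Z₂ q₂)
    (h : Disjoint Z₁ Z₂) (hX : Disjoint X (Z₁ ∪ Z₂)) :
    RobustlyCoverable φ X f (Z₁ ∪ Z₂) (q₁ + q₂) := by
  intro F hF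
  rw [Finset.card_union_of_disjoint h, mul_add] at hF ⊢
  obtain ⟨W₁, hW₁, hd₁, hc₁, hC₁⟩ := h₁ F (by omega)
  obtain ⟨W₂, hW₂, hd₂, hc₂, hC₂⟩ := h₂ (F ∪ W₁) (by
    have := Finset.card_union_le F W₁
    omega)
  rw [Finset.disjoint_union_right] at hd₂ hX
  refine ⟨W₁ ∪ W₂, Finset.union_subset hW₁ hW₂, Finset.disjoint_union_left.2 ⟨hd₁, hd₂.1⟩, ?_,
    hC₁.union hC₂ ?_⟩
  · rw [Finset.card_union_of_disjoint hd₂.2.symm, hc₁, hc₂]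
  · rw [Finset.disjoint_union_left, Finset.disjoint_union_right, Finset.disjoint_union_right]
    exact ⟨⟨h, (hX.1.mono_left hW₂).symm⟩, hX.2.mono_left hW₁, hd₂.2.symm⟩

open Classical in
theorem RobustlyCoverable.biUnion {ι : Type*} (s : Finset ι) (Z : ι → Finset V) {q : ℕ}
    (hZ : ∀ i ∈ s, RobustlyCoverable φ X f (Z i) q)
    (hd : ∀ i ∈ s, ∀ j ∈ s, i ≠ j → Disjoint (Z i) (Z j)) (hX : ∀ i ∈ s, Disjoint X (Z i)) :
    RobustlyCoverable φ X f (s.biUnion Z) (s.card * q) := by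
  induction s using Finset.induction_on with
  | empty => simpa using RobustlyCoverable.empty 0
  | insert i s hi ih =>
    rw [Finset.biUnion_insert, Finset.card_insert_of_notMem hi, add_mul, one_mul, add_comm]
    refine (hZ i (Finset.mem_insert_self _ _)).union (ih ?_ ?_ ?_) ?_ ?_
    · exact fun j hj => hZ j (Finset.mem_insert_of_mem hj)
    · exact fun j hj k hk => hd j (Finset.mem_insert_of_mem hj) k (Finset.mem_insert_of_mem hk)
    · exact fun j hj => hX j (Finset.mem_insert_of_mem hj)
    · rw [Finset.disjoint_biUnion_right]
      intro j hj
      exact hd i (Finset.mem_insert_self _ _) j (Finset.mem_insert_of_mem hj)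
        (fun h => hi (h ▸ hj))
    · rw [← Finset.biUnion_insert, Finset.disjoint_biUnion_right]
      exact hX

/-- One degenerate cycle per vertex; this handles the exceptional vertices and small sets. -/
theorem RobustlyCoverable.of_card (hr : 1 ≤ r) (hf : f ≤ X.card) (Z : Finset V)
    (hX : Disjoint X Z) : RobustlyCoverable φ X f Z Z.card := by
  classical
  have h := RobustlyCoverable.biUnion (φ := φ) (X := X) (f := f) (q := 1) Z (fun z => {z}) ?_ ?_ ?_
  · simpa using h
  · intro z _ F hF
    obtain ⟨W, hW, hc⟩ := Finset.exists_subset_card_eq (s := X \ F) (n := n) (by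
      have := Finset.le_card_sdiff F X
      simp only [Finset.card_singleton, mul_one] at hF
      omega)
    refine ⟨W, hW.trans Finset.sdiff_subset, ?_, by simpa using hc,
      coverable_singleton hr φ z W hc⟩
    exact Finset.disjoint_of_subset_left hW Finset.sdiff_disjoint
  · intro i _ j _ hij
    simpa using hij
  · intro z hz
    rw [Finset.disjoint_singleton_right]
    exact fun h => Finset.disjoint_left.1 hX h hz

/-! ### Colour links, and tight cycles from cycles of hubs -/

/-- The tuples in `X` that form an edge of colour `c` with `z`. -/
def colourLink (φ : CompleteColouring V (n + 1) r) (X : Finset V) (c : Fin r) (z : V) :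
    Set (Fin n → X) :=
  {x | Function.Injective x ∧ HasColour φ c z fun i => (x i : V)}

/-- Only mixtures with an initial segment of `y` and a final segment of `x` occur in the windows of
`coverable_blocks`. -/
theorem hasColour_of_cube {c : Fin r} {z : V} {M : Set (Fin n → X)} (hM : M ⊆ colourLink φ X c z)
    {x y : Fin n → X} (h : Cube M x y) (l : ℕ) :
    HasColour φ c z (fun i => if (i : ℕ) < l then (y i : V) else x i) := by
  have := (hM (h.symm fun i => decide ((i : ℕ) < l))).2
  convert this using 2 with i
  simp only [decide_eq_true_eq]
  split_ifs <;> rfl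

open Classical Finset in
/-- A cyclic sequence of pairs of vertices whose hubs have large consecutive intersections lies in
a monochromatic tight cycle. -/
theorem RobustlyCoverable.of_cyclic_hubs (hX0 : X.Nonempty) {c : Fin r} {m : ℕ} (hm : 2 ≤ m)
    (a b : ℕ → V)
    (ha : ∀ i < m, ∀ j < m, a i ≠ b j ∧ (a i = a j → i = j) ∧ (b i = b j → i = j))
    (haX : ∀ i < m, a i ∉ X ∧ b i ∉ X)
    (U : ℕ → Finset (Fin n → X)) {p θ : ℝ} (hp : 0 < p) (hθ : 0 < θ) (hθp : θ ≤ p ^ 2 / 16)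
    (hinter : ∀ i < m, p ^ 2 / 8 * Fintype.card (Fin n → X) ≤
      #{x | x ∈ U i ∧ x ∈ U ((i + 1) % m)})
    (hbad : ∀ i < m, (#{q : (Fin n → X) × (Fin n → X) |
        BadPair (colourLink φ X c (a i) ∩ colourLink φ X c (b i)) (U i) θ q.1 q.2} : ℝ)
      ≤ p ^ 4 / 2 ^ 12 * (Fintype.card (Fin n → X) : ℝ) ^ 2)
    (hU : ∀ i < m, ∀ x ∈ U i, x ∈ colourLink φ X c (a i) ∩ colourLink φ X c (b i))
    (hf : (n : ℝ) * f ≤ θ / 2 * #X) :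
    RobustlyCoverable φ X f ((range m).biUnion fun i => {a i, b i}) 1 := by
  have : Nonempty X := hX0.to_subtype
  let z : ℕ → V := fun j => if j % 2 = 0 then a (j / 2) else b (j / 2)
  have hz : Set.InjOn z (Set.Iio (2 * m)) := by
    intro j hj j' hj' h
    simp only [Set.mem_Iio] at hj hj'
    have d1 : j / 2 < m := by omega
    have d2 : j' / 2 < m := by omega
    simp only [z] at h
    split_ifs at h
    · have := (ha _ d1 _ d2).2.1 h
      omega
    · exact absurd h (ha _ d1 _ d2).1
    · exact absurd h.symm (ha _ d2 _ d1).1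
    · have := (ha _ d1 _ d2).2.2 h
      omega
  have hZ : (range m).biUnion (fun i => {a i, b i}) = (range (2 * m)).image z := by
    ext v
    simp only [mem_biUnion, mem_range, mem_insert, mem_singleton, mem_image]
    constructor
    · rintro ⟨i, hi, rfl | rfl⟩
      · refine ⟨2 * i, by omega, ?_⟩
        simp [z]
      · refine ⟨2 * i + 1, by omega, ?_⟩
        have d : (2 * i + 1) / 2 = i := by omega
        simp [z, d, Nat.add_mod]
    · rintro ⟨j, hj, rfl⟩
      refine ⟨j / 2, by omega, ?_⟩
      simp only [z]
      split_ifs <;> simp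
  have hZc : #((range (2 * m)).image z) = 2 * m := by
    rw [card_image_of_injOn (by simpa using hz), card_range]
  rw [hZ]
  intro F hF
  rw [hZc] at hF ⊢
  let F' : Finset X := F.subtype (· ∈ X)
  have hF' : #F' ≤ #F := by
    rw [card_subtype]; exact card_filter_le _ _
  obtain ⟨w, hw1, hw2, hw3⟩ := exists_cyclic_tuples hm
    (fun i => colourLink φ X c (a i) ∩ colourLink φ X c (b i)) U hp hθ hθp
    (fun i hi => by convert hinter i hi) hbad hU
    (fun i _ x hx => hx.1.1) F' (by
      rw [Fintype.card_coe]
      refine le_trans ?_ hf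
      have : #F' + 2 * m * n ≤ f := by nlinarith
      have h2 : ((#F' : ℝ) + 2 * m * n) ≤ f := by exact_mod_cast this
      gcongr)
  let g : ℕ × Fin n → V := fun ji => w ji.1 ji.2
  have hg : Set.InjOn g (range (2 * m) ×ˢ (univ : Finset (Fin n)) : Finset (ℕ × Fin n)) := by
    rintro ⟨j, i⟩ hj ⟨j', i'⟩ hj' h
    simp only [coe_product, coe_range, coe_univ, Set.mem_prod, Set.mem_Iio, Set.mem_univ,
      and_true] at hj hj'
    obtain ⟨rfl, rfl⟩ := hw1 j hj j' hj' i i' (Subtype.ext h)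
    rfl
  refine ⟨(range (2 * m) ×ˢ (univ : Finset (Fin n))).image g, ?_, ?_, ?_, ?_⟩
  · intro v hv
    obtain ⟨ji, -, rfl⟩ := mem_image.1 hv
    exact (w ji.1 ji.2).2
  · rw [disjoint_left]
    intro v hv hvF
    obtain ⟨ji, hji, rfl⟩ := mem_image.1 hv
    simp only [mem_product, mem_range, mem_univ, and_true] at hji
    exact hw2 ji.1 hji ji.2 (mem_subtype.2 hvF)
  · rw [card_image_of_injOn hg, card_product, card_range, card_univ, Fintype.card_fin, mul_comm]
  · refine coverable_blocks φ c (2 * m) (by omega) z (fun j i => (w j i : V)) hz ?_ ?_ ?_ _ _ ?_ ?_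
    · intro j hj j' hj' i i' h
      exact hw1 j hj j' hj' i i' (Subtype.ext h)
    · intro j hj j' hj' i h
      have d : j / 2 < m := by omega
      have hzX : z j ∉ X := by
        simp only [z]
        split_ifs
        exacts [(haX _ d).1, (haX _ d).2]
      exact hzX (h ▸ (w j' i).2)
    · intro j hj l _
      -- The cube inside pair i surrounds `b i`; the one leading from pair i to the next surrounds
      -- the next `a`.
      obtain ⟨i, rfl | rfl⟩ : ∃ i, j = 2 * i ∨ j = 2 * i + 1 := ⟨j / 2, by omega⟩
      · have d : (2 * i + 1) / 2 = i := by omega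
        rw [Nat.mod_eq_of_lt (by omega)]
        have hzi : z (2 * i + 1) = b i := by simp [z, d, Nat.add_mod]
        rw [hzi]
        exact hasColour_of_cube Set.inter_subset_right (hw3 i (by omega)).1 l
      · have e : (2 * i + 1 + 1) % (2 * m) = 2 * ((i + 1) % m) := by
          rw [← Nat.mul_mod_mul_left]; rfl
        have hzi : z (2 * ((i + 1) % m)) = a ((i + 1) % m) := by simp [z]
        rw [e, hzi]
        exact hasColour_of_cube Set.inter_subset_left (hw3 i (by omega)).2 l
    · simp
    · ext v
      simp [g]

-- Dependent random choice in the graph of cubes of M. The value θ = p^6/2^13 turns the bound 2θ/p²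
-- into p^4/2^12 = (p²/64)², as `exists_cyclic_tuples` requires.
open Classical Finset in
theorem exists_link_hub {A : Type*} [Fintype A] [Nonempty A] {n : ℕ} (M : Set (Fin n → A))
    {d p : ℝ} (hd : 0 < d) (hp : p = d ^ 2 ^ n)
    (hM : d * Fintype.card (Fin n → A) ≤ #{x | x ∈ M}) :
    ∃ U : Finset (Fin n → A), (∀ x ∈ U, x ∈ M) ∧ p / 2 * Fintype.card (Fin n → A) ≤ #U ∧
      (#{q : (Fin n → A) × (Fin n → A) | BadPair M U (p ^ 6 / 2 ^ 13) q.1 q.2} : ℝ)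
        ≤ p ^ 4 / 2 ^ 12 * (Fintype.card (Fin n → A) : ℝ) ^ 2 := by
  have hp0 : 0 < p := by rw [hp]; positivity
  have hN : 0 < Fintype.card (Fin n → A) := Fintype.card_pos
  have hN0 : (0 : ℝ) < Fintype.card (Fin n → A) := by exact_mod_cast hN
  obtain ⟨U, hU1, hU2, hU3⟩ := exists_hub (Cube M) (fun x y h => h.symm) (p := p)
    (θ := p ^ 6 / 2 ^ 13) hp0 (by positivity) hN (by
      refine le_trans ?_ (card_cube_ge n M)
      rw [hp]
      gcongr
      rwa [le_div_iff₀ hN0])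
  refine ⟨U, fun x hx => ?_, hU2, ?_⟩
  · obtain ⟨y, hy⟩ := hU1 x hx
    exact hy.left_mem
  · refine le_trans (le_of_eq ?_) (hU3.trans (le_of_eq ?_))
    · congr!
    · field_simp

end RobustlyCoverable

/-! ### Covering the vertices of one colour class -/

section

variable {V : Type*} {n r f : ℕ} {φ : CompleteColouring V (n + 1) r} {X : Finset V}

open Classical Finset in
/-- Disjoint pairs with dense hubs are covered by few cycles, if no large family of the hubs has
small pairwise intersections. -/
theorem RobustlyCoverable.of_hubs (hr : 1 ≤ r) (hX0 : X.Nonempty) {c : Fin r}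
    {p θ : ℝ} (hp : 0 < p) (hθ : 0 < θ) (hθp : θ ≤ p ^ 2 / 16)
    (hfX : f ≤ #X) (hf : (n : ℝ) * f ≤ θ / 2 * #X) (U : V × V → Finset (Fin n → X)) (t : ℕ) :
    ∀ P : Finset (V × V), (∀ e ∈ P, e.1 ≠ e.2) →
    (∀ e ∈ P, ∀ g ∈ P, e ≠ g → Disjoint ({e.1, e.2} : Finset V) {g.1, g.2}) →
    (∀ e ∈ P, Disjoint X ({e.1, e.2} : Finset V)) →
    (∀ e ∈ P, ∀ x ∈ U e, x ∈ colourLink φ X c e.1 ∩ colourLink φ X c e.2) →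
    (∀ e ∈ P, (#{q : (Fin n → X) × (Fin n → X) |
        BadPair (colourLink φ X c e.1 ∩ colourLink φ X c e.2) (U e) θ q.1 q.2} : ℝ)
      ≤ p ^ 4 / 2 ^ 12 * (Fintype.card (Fin n → X) : ℝ) ^ 2) →
    (∀ I ⊆ P, (∀ e ∈ I, ∀ g ∈ I, e ≠ g →
      (#{x | x ∈ U e ∧ x ∈ U g} : ℝ) < p ^ 2 / 8 * Fintype.card (Fin n → X)) → #I ≤ t) →
    RobustlyCoverable φ X f (P.biUnion fun e => {e.1, e.2}) (t * 2) := by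
  induction t with
  | zero =>
    intro P _ _ _ _ _ hI
    have hP : P = ∅ := by
      by_contra hne
      obtain ⟨e, he⟩ := nonempty_iff_ne_empty.2 hne
      have := hI {e} (by simpa using he) (by
        intro e' he' g hg hne
        rw [mem_singleton] at he' hg
        exact absurd (he'.trans hg.symm) hne)
      simp at this
    rw [hP]
    exact RobustlyCoverable.empty _
  | succ t ih =>
    intro P hne hdis hPX hU hbad hI
    rcases P.eq_empty_or_nonempty with rfl | hPne
    · exact RobustlyCoverable.empty _
    obtain ⟨m, u, hm, huP, hinj, hcyc, hout⟩ := exists_cycle_of_nonempty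
      (fun e g => p ^ 2 / 8 * Fintype.card (Fin n → X) ≤ (#{x | x ∈ U e ∧ x ∈ U g} : ℝ))
      (fun e g h => by simpa only [and_comm] using h) P hPne
    set L : Finset (V × V) := (range m).image u with hL
    have hLP : L ⊆ P := by
      intro e he
      obtain ⟨i, hi, rfl⟩ := mem_image.1 he
      exact huP i (mem_range.1 hi)
    -- `u 0` has no neighbour outside L, so it can be added to any independent family there:
    -- removing L lowers the bound t by one.
    have hrest := ih (P \ L) (fun e he => hne e (sdiff_subset he))
      (fun e he g hg => hdis e (sdiff_subset he) g (sdiff_subset hg))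
      (fun e he => hPX e (sdiff_subset he)) (fun e he => hU e (sdiff_subset he))
      (fun e he => hbad e (sdiff_subset he)) (by
        intro I hIs hIn
        have h0 : u 0 ∉ I := by
          intro h
          have := (mem_sdiff.1 (hIs h)).2
          exact this (mem_image_of_mem u (mem_range.2 (by omega)))
        have key : ∀ g ∈ I, (#{x | x ∈ U (u 0) ∧ x ∈ U g} : ℝ)
            < p ^ 2 / 8 * Fintype.card (Fin n → X) := by
          intro g hg
          have hg' := mem_sdiff.1 (hIs hg)
          refine not_le.1 (hout g hg'.1 fun i hi h => hg'.2 ?_)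
          rw [h]
          exact mem_image_of_mem u (mem_range.2 hi)
        have := hI (insert (u 0) I) (insert_subset (huP 0 (by omega)) (hIs.trans sdiff_subset)) (by
          intro e he g hg heg
          rcases mem_insert.1 he with rfl | he <;> rcases mem_insert.1 hg with rfl | hg
          · exact absurd rfl heg
          · exact key g hg
          · simpa only [and_comm] using key e he
          · exact hIn e he g hg heg)
        rw [card_insert_of_notMem h0] at this
        omega)
    -- A lone pair costs two degenerate cycles, a longer cycle or an edge only one tight cycle;
    -- hence the factor 2.
    have hLZ : RobustlyCoverable φ X f (L.biUnion fun e => {e.1, e.2}) 2 := by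
      rcases Nat.lt_or_ge m 2 with h | h
      · obtain rfl : m = 1 := by omega
        have hL1 : L = {u 0} := by simp [hL]
        rw [hL1, singleton_biUnion]
        exact (RobustlyCoverable.of_card hr hfX _ (hPX _ (huP 0 (by omega)))).mono card_le_two
      · have hZ : (L.biUnion fun e => {e.1, e.2})
            = (range m).biUnion fun i => {(u i).1, (u i).2} := by
          rw [hL, image_biUnion]
        rw [hZ]
        have hd : ∀ i < m, ∀ j < m, i ≠ j →
            Disjoint ({(u i).1, (u i).2} : Finset V) {(u j).1, (u j).2} :=
          fun i hi j hj hij => hdis _ (huP i hi) _ (huP j hj) fun h => hij (hinj hi hj h)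
        refine (RobustlyCoverable.of_cyclic_hubs hX0 (c := c) h (fun i => (u i).1)
          (fun i => (u i).2) ?_ ?_ (fun i => U (u i)) hp hθ hθp (fun i hi => ?_)
          (fun i hi => hbad _ (huP i hi)) (fun i hi => hU _ (huP i hi)) hf).mono (by norm_num)
        · intro i hi j hj
          by_cases hij : i = j
          · subst hij
            exact ⟨hne _ (huP i hi), fun _ => rfl, fun _ => rfl⟩
          · have h1 := disjoint_left.1 (hd i hi j hj hij)
            refine ⟨fun h => ?_, fun h => ?_, fun h => ?_⟩
            · exact absurd (show (u i).1 ∈ ({(u j).1, (u j).2} : Finset V) by simp [h]) (h1 (by simp))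
            · exact absurd (show (u i).1 ∈ ({(u j).1, (u j).2} : Finset V) by simp [h]) (h1 (by simp))
            · exact absurd (show (u i).2 ∈ ({(u j).1, (u j).2} : Finset V) by simp [h]) (h1 (by simp))
        · intro i hi
          have := disjoint_right.1 (hPX _ (huP i hi))
          exact ⟨this (by simp), this (by simp)⟩
        · exact hcyc h i hi
    have hsplit : (P.biUnion fun e => ({e.1, e.2} : Finset V))
        = ((P \ L).biUnion fun e => {e.1, e.2}) ∪ L.biUnion fun e => {e.1, e.2} := by
      rw [← union_biUnion, sdiff_union_of_subset hLP]
    have hXP : Disjoint X (P.biUnion fun e => ({e.1, e.2} : Finset V)) := by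
      rw [disjoint_biUnion_right]; exact hPX
    rw [add_mul, one_mul, hsplit]
    refine hrest.union hLZ ?_ (hsplit ▸ hXP)
    rw [disjoint_biUnion_left]
    intro e he
    rw [disjoint_biUnion_right]
    intro g hg
    exact hdis e (sdiff_subset he) g (hLP hg) fun h => (mem_sdiff.1 he).2 (h ▸ hg)

open Classical Finset in
/-- Vertices whose links all have density at least `1 / (2 r)` in one colour. -/
theorem RobustlyCoverable.of_dense_links (hr : 1 ≤ r) (hX0 : X.Nonempty) {c : Fin r} {P : ℕ}
    (hP : P = (8 * r ^ 2) ^ 2 ^ n) (hfX : f ≤ #X) (hf : 2 ^ 14 * P ^ 6 * n * f ≤ #X)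
    (Z : Finset V) (hZX : Disjoint X Z)
    (hZ : ∀ z ∈ Z, 1 / (2 * r : ℝ) * Fintype.card (Fin n → X) ≤ #{x | x ∈ colourLink φ X c z}) :
    RobustlyCoverable φ X f Z (4 * r + 4 * P * 2) := by
  have : Nonempty X := hX0.to_subtype
  have hN : 0 < Fintype.card (Fin n → X) := Fintype.card_pos
  have hr0 : (0 : ℝ) < r := by exact_mod_cast hr
  have hP0 : (0 : ℝ) < P := by
    rw [hP]; push_cast; positivity
  have hP1 : (1 : ℝ) ≤ P := by
    exact_mod_cast (Nat.cast_pos.1 hP0 : 0 < P)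
  set p : ℝ := 1 / P with hp
  have hp0 : 0 < p := by positivity
  have hp1 : p ≤ 1 := by rw [hp, div_le_one hP0]; exact hP1
  have hpd : p = (1 / (8 * r ^ 2) : ℝ) ^ 2 ^ n := by
    rw [hp, hP]; push_cast; rw [div_pow, one_pow]
  set θ : ℝ := p ^ 6 / 2 ^ 13 with hθ
  have hθp : θ ≤ p ^ 2 / 16 := by
    have : p ^ 6 ≤ p ^ 2 := pow_le_pow_of_le_one hp0.le hp1 (by norm_num)
    rw [hθ]
    have : 0 < p ^ 2 := by positivity
    linarith
  have hf' : (n : ℝ) * f ≤ θ / 2 * #X := by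
    have h1 : (2 ^ 14 * (P : ℝ) ^ 6 * n * f) ≤ #X := by exact_mod_cast hf
    have h2 : θ / 2 * (2 ^ 14 * (P : ℝ) ^ 6 * n * f) = n * f := by
      rw [hθ, hp]; field_simp
    rw [← h2]
    exact mul_le_mul_of_nonneg_left h1 (by positivity)
  -- The threshold 1/(8r²) is δ²/2 for δ = 1/(2r), so the unmatched set R has fewer than 2/δ = 4r
  -- elements.
  obtain ⟨Q, R, hQadj, hQdis, hQR, hQZ, hRnon⟩ := exists_maximal_matching
    (fun a b => 1 / (8 * r ^ 2 : ℝ) * Fintype.card (Fin n → X) ≤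
      (#{x | x ∈ colourLink φ X c a ∩ colourLink φ X c b} : ℝ)) Z
  have hRZ : R ⊆ Z := hQZ ▸ subset_union_left
  have hQsub : ∀ e ∈ Q, ({e.1, e.2} : Finset V) ⊆ Z := fun e he => by
    rw [← hQZ]
    exact (subset_biUnion_of_mem (fun e : V × V => ({e.1, e.2} : Finset V)) he).trans
      subset_union_right
  have hRcard : #R ≤ 4 * r := by
    have h := card_mul_lt_two_of_inter_lt R
      (fun z => ({x | x ∈ colourLink φ X c z} : Finset (Fin n → X))) (δ := 1 / (2 * r))
      (by positivity) hN (fun z hz => hZ z (hRZ hz)) (by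
        intro a ha b hb hab
        have h1 := not_le.1 (hRnon a ha b hb hab)
        refine lt_of_eq_of_lt ?_ (h1.trans_eq ?_)
        · congr 2
          ext x
          simp
        · congr 1
          field_simp
          norm_num)
    have h2 : (#R : ℝ) < 4 * r := by
      rw [mul_one_div, div_lt_iff₀ (by positivity)] at h
      linarith
    exact_mod_cast h2.le
  have hhub : ∀ e : V × V, ∃ U : Finset (Fin n → X), e ∈ Q →
      (∀ x ∈ U, x ∈ colourLink φ X c e.1 ∩ colourLink φ X c e.2) ∧
      p / 2 * Fintype.card (Fin n → X) ≤ #U ∧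
      (#{q : (Fin n → X) × (Fin n → X) |
        BadPair (colourLink φ X c e.1 ∩ colourLink φ X c e.2) U θ q.1 q.2} : ℝ)
      ≤ p ^ 4 / 2 ^ 12 * (Fintype.card (Fin n → X) : ℝ) ^ 2 := by
    intro e
    by_cases he : e ∈ Q
    · obtain ⟨U, hU⟩ := exists_link_hub (colourLink φ X c e.1 ∩ colourLink φ X c e.2)
        (by positivity) hpd (by convert (hQadj e he).2)
      exact ⟨U, fun _ => hU⟩
    · exact ⟨∅, fun h => absurd h he⟩
  choose U hU using hhub
  have hRcov : RobustlyCoverable φ X f R (4 * r) :=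
    (RobustlyCoverable.of_card hr hfX R (hZX.mono_right hRZ)).mono hRcard
  have hQcov := RobustlyCoverable.of_hubs (φ := φ) (c := c) hr hX0 hp0 (by positivity) hθp hfX hf' U
    (4 * P) Q (fun e he => (hQadj e he).1) hQdis (fun e he => hZX.mono_right (hQsub e he))
    (fun e he => (hU e he).1) (fun e he => (hU e he).2.2) (by
      intro I hIQ hI
      have h := card_mul_lt_two_of_inter_lt I U (δ := p / 2) (by positivity) hN
        (fun e he => (hU e (hIQ he)).2.1) (by
          intro e he g hg heg
          refine lt_of_eq_of_lt ?_ ((hI e he g hg heg).trans_eq ?_)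
          · congr 2
            ext x
            simp
          · congr 1
            ring)
      have h2 : (#I : ℝ) < 4 * P := by
        rw [hp, div_div, mul_one_div, div_lt_iff₀ (by positivity)] at h
        linarith
      exact_mod_cast h2.le)
  have := hRcov.union hQcov (by
    rw [disjoint_biUnion_right]
    exact fun e he => (hQR e he).symm) (by rwa [hQZ])
  rwa [hQZ] at this

open Classical Finset in
/-- If at least half of the tuples are injective, some colour has density `1 / (2 r)` in the link of
any given vertex. -/
theorem exists_dense_colourLink (hr : 1 ≤ r) (hX : 2 * n ^ 2 ≤ #X) {z : V} (hz : z ∉ X) :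
    ∃ c : Fin r, 1 / (2 * r : ℝ) * Fintype.card (Fin n → X) ≤ #{x | x ∈ colourLink φ X c z} := by
  have hr0 : (0 : ℝ) < r := by exact_mod_cast hr
  have h1 : Fintype.card (Fin n → X) ≤ 2 * #{x : Fin n → X | Function.Injective x} := by
    convert card_le_two_mul_card_injective (A := X) n (by simpa using hX)
  have hsub : ({x : Fin n → X | Function.Injective x} : Finset (Fin n → X))
      ⊆ univ.biUnion fun c : Fin r => {x | x ∈ colourLink φ X c z} := by
    intro x hx
    simp only [mem_filter, mem_univ, true_and, mem_biUnion] at hx ⊢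
    have hcard : #(insert z (univ.image fun i => (x i : V))) = n + 1 := by
      rw [card_insert_of_notMem, card_image_of_injective _ fun i j h => hx (Subtype.ext h),
        card_univ, Fintype.card_fin]
      intro h
      obtain ⟨i, -, rfl⟩ := mem_image.1 h
      exact hz (x i).2
    refine ⟨φ ⟨_, hcard⟩, hx, fun e he => ?_⟩
    congr 1
    refine Subtype.ext (coe_injective (he.trans ?_))
    simp
  have h2 : (#{x : Fin n → X | Function.Injective x} : ℝ)
      ≤ ∑ c : Fin r, (#{x | x ∈ colourLink φ X c z} : ℝ) := by
    exact_mod_cast (card_le_card hsub).trans card_biUnion_le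
  have h1' : (Fintype.card (Fin n → X) : ℝ) ≤ 2 * #{x : Fin n → X | Function.Injective x} := by
    exact_mod_cast h1
  obtain ⟨c, -, hc⟩ := exists_le_of_sum_le (s := (univ : Finset (Fin r)))
    (f := fun _ => 1 / (2 * r : ℝ) * Fintype.card (Fin n → X))
    (g := fun c => (#{x | x ∈ colourLink φ X c z} : ℝ)) ⟨⟨0, hr⟩, mem_univ _⟩ (by
      rw [sum_const, card_univ, Fintype.card_fin, nsmul_eq_mul]
      refine le_trans (le_of_eq ?_) (le_trans (show (Fintype.card (Fin n → X) : ℝ) / 2 ≤ _ by linarith) h2)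
      field_simp)
  exact ⟨c, hc⟩

end

/-! ### Covering all of Z -/

section

variable {V : Type*} {n r f : ℕ} {φ : CompleteColouring V (n + 1) r} {X : Finset V}

open Classical Finset in
/-- If `X` is sufficiently large, any set of vertices is robustly coverable by a bounded number of
cycles. -/
theorem RobustlyCoverable.of_large (hr : 1 ≤ r) (hX0 : X.Nonempty) {P : ℕ}
    (hP : P = (8 * r ^ 2) ^ 2 ^ n) (hX : 2 * n ^ 2 ≤ #X) (hfX : f ≤ #X)
    (hf : 2 ^ 14 * P ^ 6 * n * f ≤ #X) (Z : Finset V) (hZX : Disjoint X Z) :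
    RobustlyCoverable φ X f Z (r * (4 * r + 4 * P * 2)) := by
  have hcol : ∀ z : V, ∃ c : Fin r, z ∈ Z →
      1 / (2 * r : ℝ) * Fintype.card (Fin n → X) ≤ #{x | x ∈ colourLink φ X c z} := by
    intro z
    by_cases hz : z ∈ Z
    · obtain ⟨c, hc⟩ := exists_dense_colourLink (φ := φ) hr hX (disjoint_right.1 hZX hz)
      exact ⟨c, fun _ => hc⟩
    · exact ⟨⟨0, hr⟩, fun h => absurd h hz⟩
  choose col hcol using hcol
  have hZ : (univ : Finset (Fin r)).biUnion (fun c => {z ∈ Z | col z = c}) = Z := by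
    ext z
    simp
  have h := RobustlyCoverable.biUnion (φ := φ) (X := X) (f := f) (q := 4 * r + 4 * P * 2)
    (univ : Finset (Fin r)) (fun c => {z ∈ Z | col z = c})
    (fun c _ => RobustlyCoverable.of_dense_links (c := c) hr hX0 hP hfX hf _
      (hZX.mono_right (filter_subset _ _)) (by
        intro z hz
        obtain ⟨hz, rfl⟩ := mem_filter.1 hz
        exact hcol z ‹z ∈ Z›))
    (by
      intro c _ c' _ hcc
      rw [disjoint_left]
      intro z hz hz'
      exact hcc ((mem_filter.1 hz).2.symm.trans (mem_filter.1 hz').2))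
    (fun c _ => hZX.mono_right (filter_subset _ _))
  rwa [hZ, card_univ, Fintype.card_fin] at h

-- Deleting F from X first leaves only the budget n |Z| for the cover itself, which may be far
-- smaller than f.
open Classical Finset in
theorem RobustlyCoverable.of_sdiff {Z : Finset V} {q : ℕ}
    (h : ∀ F : Finset V, #F + n * #Z ≤ f → RobustlyCoverable φ (X \ F) (n * #Z) Z q) :
    RobustlyCoverable φ X f Z q := by
  intro F hF
  obtain ⟨W, h1, -, h3, h4⟩ := h F hF ∅ (by simp)
  exact ⟨W, h1.trans sdiff_subset, disjoint_of_subset_left h1 sdiff_disjoint, h3, h4⟩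

open Classical Finset in
/-- A large set is covered by covering its pieces of size at most `s`. -/
theorem RobustlyCoverable.of_small_subsets {s q : ℕ} {Z : Finset V} (hZX : Disjoint X Z)
    (h : ∀ Y ⊆ Z, #Y ≤ s → RobustlyCoverable φ X f Y q) (D : ℕ) :
    ∀ Y ⊆ Z, #Y ≤ D * s → RobustlyCoverable φ X f Y (D * q) := by
  induction D with
  | zero =>
    intro Y _ hc
    rw [zero_mul, Nat.le_zero, card_eq_zero] at hc
    rw [hc]
    exact RobustlyCoverable.empty _
  | succ D ih =>
    intro Y hY hc
    obtain ⟨T, hTY, hT⟩ := exists_subset_card_eq (s := Y) (n := min s #Y) (min_le_right _ _)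
    have hrest := ih (Y \ T) (sdiff_subset.trans hY) (by
      rw [card_sdiff_of_subset hTY, hT]
      rw [add_mul, one_mul] at hc
      omega)
    have := hrest.union (h T (hTY.trans hY) (hT ▸ min_le_left _ _)) sdiff_disjoint
      (by rw [sdiff_union_of_subset hTY]; exact hZX.mono_right hY)
    rwa [sdiff_union_of_subset hTY, ← Nat.succ_mul] at this

end

-- `RobustlyCoverable.of_large` asks X to be larger, relative to the set covered, than the
-- hypothesis guarantees for the whole of Z. It does apply to each of D parts, since at least half
-- of X remains throughout.
open Classical Finset in
theorem robustlyCoverable_of_card_ge {V : Type*} {n r : ℕ} (hr : 1 ≤ r)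
    (φ : CompleteColouring V (n + 1) r) (X Z : Finset V) (hXZ : Disjoint X Z) {Q : ℕ}
    (hQ : Q = (2 * r) ^ 2 ^ n) (hX : 2 ^ 5 * r * (n + 1) * Q ^ 4 * #Z ≤ #X) :
    RobustlyCoverable φ X (n * #Z) Z (2 ^ 18 * r * Q ^ 20) := by
  have h2r : 2 * r ≤ Q := by
    rw [hQ]; exact Nat.le_self_pow (by positivity) _
  have hnQ : n + 1 ≤ Q := by
    have h1 : n + 1 ≤ 2 ^ n := Nat.lt_two_pow_self
    have h2 : 2 ^ n ≤ 2 ^ 2 ^ n := Nat.lt_two_pow_self.le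
    have h3 : 2 ^ 2 ^ n ≤ (2 * r) ^ 2 ^ n := Nat.pow_le_pow_left (by omega) _
    omega
  have hQ0 : 0 < Q := by omega
  obtain ⟨P, hP⟩ : ∃ P, P = (8 * r ^ 2) ^ 2 ^ n := ⟨_, rfl⟩
  have hPQ : P ≤ Q ^ 3 := by
    rw [hP, hQ, ← pow_mul, mul_comm (2 ^ n) 3, pow_mul]
    refine Nat.pow_le_pow_left ?_ _
    have : r ^ 2 ≤ r ^ 3 := Nat.pow_le_pow_right hr (by norm_num)
    calc 8 * r ^ 2 ≤ 8 * r ^ 3 := by omega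
      _ = (2 * r) ^ 3 := by ring
  rcases Nat.eq_zero_or_pos #Z with hZ0 | hZ0
  · rw [card_eq_zero.1 hZ0]
    exact RobustlyCoverable.empty _
  have hQ4 : Q ≤ Q ^ 4 := Nat.le_self_pow (by norm_num) _
  have hfX : 2 * (n * #Z) ≤ #X := by
    refine le_trans ?_ hX
    have h1 : 1 ≤ r * Q ^ 4 := Nat.mul_pos hr (by positivity)
    calc 2 * (n * #Z) ≤ 2 ^ 5 * (n + 1) * #Z * 1 := by nlinarith
      _ ≤ 2 ^ 5 * (n + 1) * #Z * (r * Q ^ 4) := Nat.mul_le_mul_left _ h1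
      _ = _ := by ring
  -- Chosen so that 2^14 Q^18 (n + 1)² s = 2^3 (n + 1) Q^4 · D s for parts of size s; here Q^18
  -- bounds P^6, and D s ≤ 2 |Z|.
  obtain ⟨D, hD⟩ : ∃ D, D = 2 ^ 11 * Q ^ 14 * (n + 1) := ⟨_, rfl⟩
  have hD0 : 0 < D := by rw [hD]; positivity
  rcases Nat.lt_or_ge D #Z with hDZ | hDZ
  · set s := #Z / D + 1 with hs
    have hsD : D * s ≤ 2 * #Z := by
      have := Nat.div_mul_le_self #Z D
      rw [hs, mul_add, mul_one, mul_comm]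
      omega
    have hZs : #Z ≤ D * s := by
      have := Nat.lt_mul_div_succ #Z hD0
      rw [hs]; omega
    refine (RobustlyCoverable.of_small_subsets (q := r * (4 * r + 4 * P * 2)) hXZ ?_ D Z
      subset_rfl hZs).mono ?_
    · intro Y hY hYs
      refine RobustlyCoverable.of_sdiff fun F hF => ?_
      have hXF : #X ≤ #(X \ F) + #F := by
        have := le_card_sdiff F X
        omega
      have hhalf : 2 ^ 4 * r * (n + 1) * Q ^ 4 * #Z ≤ #(X \ F) := by
        have : 2 ^ 5 * r * (n + 1) * Q ^ 4 * #Z = 2 * (2 ^ 4 * r * (n + 1) * Q ^ 4 * #Z) := by ring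
        omega
      have hnn : 2 * n ^ 2 ≤ #(X \ F) := by
        refine le_trans ?_ hhalf
        have h1 : 1 ≤ r * #Z := Nat.mul_pos hr hZ0
        have h2 : n + 1 ≤ Q ^ 4 := hnQ.trans hQ4
        calc 2 * n ^ 2 ≤ 2 ^ 4 * (n + 1) * (n + 1) * 1 := by nlinarith
          _ ≤ 2 ^ 4 * (n + 1) * Q ^ 4 * (r * #Z) := by gcongr
          _ = _ := by ring
      refine RobustlyCoverable.of_large hr ?_ hP hnn ?_ ?_ Y
        (disjoint_of_subset_left sdiff_subset (hXZ.mono_right hY))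
      · rw [← card_pos]
        exact lt_of_lt_of_le (by positivity) hhalf
      · omega
      · refine le_trans ?_ hhalf
        calc 2 ^ 14 * P ^ 6 * n * (n * #Y) ≤ 2 ^ 14 * (Q ^ 3) ^ 6 * (n + 1) * ((n + 1) * s) := by
              gcongr <;> omega
          _ = 2 ^ 3 * (n + 1) * Q ^ 4 * (D * s) := by rw [hD]; ring
          _ ≤ 2 ^ 3 * (n + 1) * Q ^ 4 * (2 * #Z) := Nat.mul_le_mul_left _ hsD
          _ = 2 ^ 4 * 1 * (n + 1) * Q ^ 4 * #Z := by ring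
          _ ≤ 2 ^ 4 * r * (n + 1) * Q ^ 4 * #Z := by gcongr
    · have h1 : 4 * r + 4 * P * 2 ≤ 16 * Q ^ 3 := by
        have : Q ≤ Q ^ 3 := Nat.le_self_pow (by norm_num) _
        omega
      calc D * (r * (4 * r + 4 * P * 2)) ≤ 2 ^ 11 * Q ^ 14 * Q * (r * (16 * Q ^ 3)) := by
            rw [hD]; gcongr
        _ = 2 ^ 15 * r * Q ^ 18 := by ring
        _ ≤ 2 ^ 18 * r * Q ^ 20 := by gcongr <;> omega
  · refine (RobustlyCoverable.of_card hr (by omega) Z hXZ).mono (hDZ.trans ?_)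
    calc D ≤ 2 ^ 11 * Q ^ 14 * Q := by rw [hD]; gcongr
      _ = 2 ^ 11 * 1 * Q ^ 15 := by ring
      _ ≤ 2 ^ 18 * r * Q ^ 20 := by gcongr <;> omega

theorem mainTheorem4 {V : Type*} [Fintype V] (k r : ℕ) (hk : 1 ≤ k) (hr : 1 ≤ r)
    (φ : CompleteColouring V k r) (X Z : Finset V) (hXZ : Disjoint X Z)
    (hX : 2 ^ 5 * r * k * (2 * r) ^ (2 ^ (k + 1)) * Z.card ≤ X.card) :
    ∃ 𝒞 : Finset (Hypergraph V),
      (∀ C ∈ 𝒞, IsTightCycle k C ∧ IsMonochromatic φ C) ∧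
      (𝒞 : Set (Hypergraph V)).PairwiseDisjoint Hypergraph.vertexSet ∧
      (Z : Set V) ⊆ ⋃ C ∈ 𝒞, C.vertexSet ∧
      (𝒞.card : ℝ) ≤ 2 ^ 18 * r * (deltaZero k r ^ 5)⁻¹ ∧
      ((⋃ C ∈ 𝒞, C.vertexSet) ∩ X).ncard = (k - 1) * Z.card := by
  obtain ⟨n, rfl⟩ : ∃ n, k = n + 1 := ⟨k - 1, by omega⟩
  -- With Q = (2r)^(2^n), the constants become δ₀⁻¹ = Q^4 and δ₀⁻⁵ = Q^20.
  have hpow : ∀ a : ℕ, a ^ 2 ^ (n + 1 + 1) = (a ^ 2 ^ n) ^ 4 := fun a => by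
    rw [← pow_mul]; congr 1; ring
  obtain ⟨W, hWX, -, hWc, 𝒞, h1, h2, h3, h4⟩ :=
    robustlyCoverable_of_card_ge hr φ X Z hXZ rfl (by rwa [hpow] at hX) ∅ (by simp)
  refine ⟨𝒞, h1, h2, h3 ▸ Set.subset_union_left, ?_, ?_⟩
  · have h5 : (𝒞.card : ℝ) ≤ 2 ^ 18 * r * ((2 * r) ^ 2 ^ n) ^ 20 := by exact_mod_cast h4
    refine h5.trans (le_of_eq ?_)
    have hδ : deltaZero (n + 1) r = ((((2 * (r : ℝ)) ^ 2 ^ n) ^ 4))⁻¹ := by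
      rw [deltaZero, ← pow_mul]; congr 2; ring
    rw [hδ, inv_pow, inv_inv, ← pow_mul _ 4]
  · have h5 : ((Z : Set V) ∪ W) ∩ X = W := by
      rw [Set.union_inter_distrib_right]
      have h6 : (Z : Set V) ∩ X = ∅ := by
        rw [← Set.disjoint_iff_inter_eq_empty]
        exact_mod_cast hXZ.symm
      rw [h6, Set.empty_union, Set.inter_eq_left]
      exact_mod_cast hWX
    rw [h3, h5, Set.ncard_coe_finset, hWc, Nat.add_sub_cancel]
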